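/- Let $M,N$ be smooth manifolds (Hausdorff, paracompact, finite-dimensional), $h:M\to N$ and $\eta:N\to M$ diffeomorphisms, and $\nu:F\to N$ a smooth vector bundle of rank $p$. Let $((F,\nu,N),[\,,]_{F,h},(\rho,\eta))$ be a generalized Lie algebroid: $\rho:F\to TM$ is a smooth vector bundle morphism over $\eta$, and $[\,,]_{F,h}$ is a biadditive operation on the space $\Gamma(F)$ of smooth sections such that $[u,u]_{F,h}=0$, the Jacobi identity holds, and $$[u,fv]_{F,h}=f[u,v]_{F,h}+X_u(f)\,v\qquad(u,v\in\Gamma(F),\ f\in C^\infty(N)),$$ where $X_u=\Gamma(Th\circ\rho,h\circ\eta)(u)=Th\circ\rho\circ u\circ(h\circ\eta)^{-1}$, a vector field on $N$. The pull-back bundle $h^*F\to M$ carries the pull-back Lie algebroid structure. Its bracket on sections over an open set $U\subseteq M$ is local and is determined by $[u\circ h,v\circ h]_{h^*F}=[u,v]_{F,h}\circ h$. Its anchor, also local on sections, sends $u\circ h$ to the vector field $(Th)^{-1}\circ X_u\circ h=\rho\circ u\circ\eta^{-1}$ on $M$; write $\rho(S)(f)$ for the resulting derivative of a function $f$ along the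 image of a section $S$ of $h^*F$. A $1$-form on $h^*F|_U$ is a $C^\infty(U)$-linear map $\Gamma(h^*F|_U)\to C^\infty(U)$; for $1$-forms $\theta,\psi$ put $$d^{h^*F}\theta(S,T)=\rho(S)(\theta(T))-\rho(T)(\theta(S))-\theta([S,T]_{h^*F}),\qquad(\psi\wedge\theta)(S,T)=\psi(S)\theta(T)-\psi(T)\theta(S).$$ Let $E$ be an interior differential system, that is, a smooth vector subbundle of $h^*F$, of rank $r$. It is called involutive if $[S,T]_{h^*F}\in\Gamma(E)$ for all $S,T\in\Gamma(E)$. For $U$ open let $\Gamma(E^0|_U)$ be the $C^\infty(U)$-module of the $1$-forms on $h^*F|_U$ which vanish on $\Gamma(E|_U)$. Let $\mathcal A$ be an atlas of $M$ consisting of smooth charts whose domains are also domains of bundle charts of $h^*F$, and suppose that for each chart domain $U$ of $\mathcal A$ a basis $\Theta^{r+1},\dots,\Theta^p$ (depending on $U$) of the $C^\infty(U)$-module $\Gamma(E^0|_U)$ is given. Then $E$ is involutive if and only if for each chart domain $U$ of $\mathcal A$ there are $1$-forms $\Omega^\alpha_\beta$ on $h^*F|_U$ ($\alpha,\beta\in\{r+1,\dots,p\}$)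 such that $$d^{h^*F}\Theta^\alpha=\sum_{\beta=r+1}^p\Omega^\alpha_\beta\wedge\Theta^\beta,\qquad \alpha\in\{r+1,\dots,p\}.$$ -/

import Mathlib

open Bundle Manifold ContDiff Topology Set TopologicalSpace

set_option linter.unusedSectionVars false

namespace GenLie

noncomputable section

/-! ### Sections of a vector bundle over an open subset, as a module over the smooth functions -/

section Sections

variable (m : ℕ) {M : Type*} [TopologicalSpace M] [ChartedSpace (EuclideanSpace ℝ (Fin m)) M]

/-- The ring of smooth real functions on the open subset `U`. -/
abbrev SmoothFun (U : Opens M) : Type _ := C^∞⟮𝓡 m, U; 𝓘(ℝ, ℝ), ℝ⟯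

variable (p : ℕ) (W : M → Type*) [∀ x, AddCommGroup (W x)] [∀ x, Module ℝ (W x)]
  [∀ x, TopologicalSpace (W x)] [TopologicalSpace (TotalSpace (EuclideanSpace ℝ (Fin p)) W)]
  [FiberBundle (EuclideanSpace ℝ (Fin p)) W]

/-- Smoothness of a section, defined over the open subset `U`, of the vector bundle `W`. -/
def IsSmoothSection (U : Opens M) (s : ∀ x : U, W x) : Prop :=
  ContMDiff (𝓡 m) ((𝓡 m).prod 𝓘(ℝ, EuclideanSpace ℝ (Fin p))) ∞
    (fun x : U => (⟨(x : M), s x⟩ : TotalSpace (EuclideanSpace ℝ (Fin p)) W))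

theorem isSmoothSection_iff (U : Opens M) (s : ∀ x : U, W x) :
    IsSmoothSection m p W U s ↔ ∀ x₀ : U, ContMDiffAt (𝓡 m) 𝓘(ℝ, EuclideanSpace ℝ (Fin p)) ∞
      (fun x : U => (trivializationAt (EuclideanSpace ℝ (Fin p)) W (x₀ : M)
        ⟨(x : M), s x⟩).2) x₀ := by
  refine forall_congr' fun x₀ => ?_
  rw [contMDiffAt_totalSpace, and_iff_right]
  exact contMDiff_subtype_val x₀

variable [VectorBundle ℝ (EuclideanSpace ℝ (Fin p)) W]

theorem eventually_mem_baseSet (U : Opens M) (x₀ : U) :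
    ∀ᶠ x : U in 𝓝 x₀, (x : M) ∈
      (trivializationAt (EuclideanSpace ℝ (Fin p)) W (x₀ : M)).baseSet :=
  continuous_subtype_val.continuousAt.eventually
    ((trivializationAt (EuclideanSpace ℝ (Fin p)) W (x₀ : M)).open_baseSet.mem_nhds
      (mem_baseSet_trivializationAt _ W _))

/-- The additive group of smooth sections over `U` of the vector bundle `W`. -/
def localSections (U : Opens M) : AddSubgroup (∀ x : U, W x) where
  carrier := {s | IsSmoothSection m p W U s}
  zero_mem' := by
    change IsSmoothSection m p W U _
    rw [isSmoothSection_iff]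
    intro x₀
    refine (contMDiffAt_const (c := (0 : EuclideanSpace ℝ (Fin p)))).congr_of_eventuallyEq ?_
    filter_upwards [eventually_mem_baseSet p W U x₀] with x hx
    exact ((trivializationAt (EuclideanSpace ℝ (Fin p)) W (x₀ : M)).linear ℝ hx).map_zero
  add_mem' := by
    intro s t hs ht
    change IsSmoothSection m p W U _ at *
    rw [isSmoothSection_iff] at *
    intro x₀
    refine ((hs x₀).add (ht x₀)).congr_of_eventuallyEq ?_
    filter_upwards [eventually_mem_baseSet p W U x₀] with x hx
    exact ((trivializationAt (EuclideanSpace ℝ (Fin p)) W (x₀ : M)).linear ℝ hx).map_add _ _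
  neg_mem' := by
    intro s hs
    change IsSmoothSection m p W U _ at *
    rw [isSmoothSection_iff] at *
    intro x₀
    refine (hs x₀).neg.congr_of_eventuallyEq ?_
    filter_upwards [eventually_mem_baseSet p W U x₀] with x hx
    exact ((trivializationAt (EuclideanSpace ℝ (Fin p)) W (x₀ : M)).linear ℝ hx).map_neg _

/-- Multiplication of sections over `U` by smooth functions on `U`, pointwise. -/
instance (U : Opens M) : SMul (SmoothFun m U) (localSections m p W U) where
  smul f s := ⟨fun x => f x • s.1 x, by
    have hs := s.2
    change IsSmoothSection m p W U _ at hs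
    change IsSmoothSection m p W U _
    rw [isSmoothSection_iff] at *
    intro x₀
    refine ((f.contMDiff x₀).smul (hs x₀)).congr_of_eventuallyEq ?_
    filter_upwards [eventually_mem_baseSet p W U x₀] with x hx
    exact ((trivializationAt (EuclideanSpace ℝ (Fin p)) W (x₀ : M)).linear ℝ hx).map_smul _ _⟩

theorem smul_apply (U : Opens M) (f : SmoothFun m U) (s : localSections m p W U)
    (x : U) : (f • s).1 x = f x • s.1 x := rfl

instance (U : Opens M) : Module (SmoothFun m U) (localSections m p W U) where
  one_smul s := Subtype.ext <| funext fun x => one_smul ℝ (s.1 x)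
  mul_smul f g s := Subtype.ext <| funext fun x => mul_smul (f x) (g x) (s.1 x)
  smul_zero f := Subtype.ext <| funext fun x => smul_zero (f x)
  smul_add f s t := Subtype.ext <| funext fun x => smul_add (f x) (s.1 x) (t.1 x)
  add_smul f g s := Subtype.ext <| funext fun x => add_smul (f x) (g x) (s.1 x)
  zero_smul s := Subtype.ext <| funext fun x => zero_smul ℝ (s.1 x)

/-- `U` is the domain of a bundle chart of `W`: over `U` there is a smooth frame of `W`. -/
def IsBundleChartDomain (U : Opens M) : Prop :=
  ∃ t : Fin p → localSections m p W U, ∀ x : U, LinearIndependent ℝ fun a => (t a).1 x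

/-- A vector subbundle of rank `r` of `W`: a family of linear subspaces of the fibres which is
locally spanned by `r` smooth, pointwise linearly independent sections. -/
structure VectorSubbundle (r : ℕ) where
  fiber : ∀ x, Submodule ℝ (W x)
  exists_frame : ∀ x₀ : M, ∃ U : Opens M, x₀ ∈ U ∧ ∃ s : Fin r → localSections m p W U,
    ∀ x : U, LinearIndependent ℝ (fun a => (s a).1 x) ∧
      Submodule.span ℝ (range fun a => (s a).1 x) = fiber x

variable {m p W}

/-- The submodule `Γ(E|U)` of `Γ(W|U)`: the smooth sections over `U` with values in `E`. -/
def VectorSubbundle.sections {r : ℕ} (E : VectorSubbundle m p W r) (U : Opens M) :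
    Submodule (SmoothFun m U) (localSections m p W U) where
  carrier := {s | ∀ x : U, s.1 x ∈ E.fiber x}
  zero_mem' := fun x => (E.fiber x).zero_mem
  add_mem' := fun hs ht x => (E.fiber x).add_mem (hs x) (ht x)
  smul_mem' := fun f _ hs x => (E.fiber x).smul_mem (f x) (hs x)

variable (m p W)

/-- The `1`-forms over `U`: the linear forms on the module `Γ(W|U)` over the smooth functions. -/
abbrev OneForm (U : Opens M) : Type _ := Module.Dual (SmoothFun m U) (localSections m p W U)

variable {m p W}

/-- The exterior product of two `1`-forms, as a `2`-form (a function of two sections). -/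
def wedge {U : Opens M} (ψ θ : OneForm m p W U) (S T : localSections m p W U) : SmoothFun m U :=
  ψ S * θ T - ψ T * θ S

/-- The submodule `Γ(E⁰|U)` of the `1`-forms over `U` which vanish on `Γ(E|U)`. -/
def VectorSubbundle.annihilator {r : ℕ} (E : VectorSubbundle m p W r) (U : Opens M) :
    Submodule (SmoothFun m U) (OneForm m p W U) :=
  (E.sections U).dualAnnihilator

end Sections

/-! ### Generalized Lie algebroids -/

section Algebroid

variable {m n : ℕ} {M N : Type*}
  [TopologicalSpace M] [ChartedSpace (EuclideanSpace ℝ (Fin m)) M] [IsManifold (𝓡 m) ∞ M]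
  [TopologicalSpace N] [ChartedSpace (EuclideanSpace ℝ (Fin n)) N] [IsManifold (𝓡 n) ∞ N]
  (p : ℕ) (F : N → Type*) [∀ y, AddCommGroup (F y)] [∀ y, Module ℝ (F y)]
  [∀ y, TopologicalSpace (F y)] [TopologicalSpace (TotalSpace (EuclideanSpace ℝ (Fin p)) F)]
  [FiberBundle (EuclideanSpace ℝ (Fin p)) F] [VectorBundle ℝ (EuclideanSpace ℝ (Fin p)) F]

/-- The module `Γ(F)` of global smooth sections of `F`. -/
abbrev GlobalSection : Type _ := Cₛ^∞⟮𝓡 n; EuclideanSpace ℝ (Fin p), F⟯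

variable {p F} in
/-- Multiplication of a global section by a smooth function. -/
def mulSection (f : C^∞⟮𝓡 n, N; 𝓘(ℝ, ℝ), ℝ⟯) (u : GlobalSection (n := n) p F) :
    GlobalSection (n := n) p F :=
  ⟨fun y => f y • u y, f.contMDiff.smul_section u.contMDiff⟩

variable {p F} in
/-- The derivative at `y` of the function `f` on `N` along the vector field
`(Th ∘ ρ) ∘ u ∘ (h ∘ η)⁻¹` on `N`. -/
def anchorDeriv (h : M ≃ₘ⟮𝓡 m, 𝓡 n⟯ N) (η : N ≃ₘ⟮𝓡 n, 𝓡 m⟯ M)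
    (ρ : ∀ y, F y →ₗ[ℝ] TangentSpace (𝓡 m) (η y)) (u : GlobalSection (n := n) p F)
    (f : N → ℝ) (y : N) : ℝ :=
  mfderiv (𝓡 n) 𝓘(ℝ, ℝ) f (h (η (η.symm (h.symm y))))
    (mfderiv (𝓡 m) (𝓡 n) h (η (η.symm (h.symm y)))
      (ρ (η.symm (h.symm y)) (u (η.symm (h.symm y)))))

/-- A generalized Lie algebroid structure on the vector bundle `F` over `N`, for the
diffeomorphisms `η : N → M` and `h : M → N`: a vector bundle morphism `(ρ, η)` from `F` to `TM`
and a Lie bracket on `Γ(F)` which satisfies the Leibniz rule with respect to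
`Γ(Th ∘ ρ, h ∘ η)`. -/
structure GeneralizedLieAlgebroid (h : M ≃ₘ⟮𝓡 m, 𝓡 n⟯ N) (η : N ≃ₘ⟮𝓡 n, 𝓡 m⟯ M) where
  ρ : ∀ y, F y →ₗ[ℝ] TangentSpace (𝓡 m) (η y)
  contMDiff_ρ : ContMDiff ((𝓡 n).prod 𝓘(ℝ, EuclideanSpace ℝ (Fin p))) (𝓡 m).tangent ∞
    (fun v : TotalSpace (EuclideanSpace ℝ (Fin p)) F =>
      (⟨η v.1, ρ v.1 v.2⟩ : TangentBundle (𝓡 m) M))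
  bracket : GlobalSection (n := n) p F → GlobalSection (n := n) p F → GlobalSection (n := n) p F
  bracket_add : ∀ u v w, bracket u (v + w) = bracket u v + bracket u w
  add_bracket : ∀ u v w, bracket (u + v) w = bracket u w + bracket v w
  bracket_self : ∀ u, bracket u u = 0
  jacobi : ∀ u v w,
    bracket u (bracket v w) + bracket w (bracket u v) + bracket v (bracket w u) = 0
  leibniz : ∀ (u v : GlobalSection (n := n) p F) (f : C^∞⟮𝓡 n, N; 𝓘(ℝ, ℝ), ℝ⟯) (y : N),
    bracket u (mulSection f v) y = f y • bracket u v y + anchorDeriv h η ρ u f y • v y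

end Algebroid

/-! ### The pull-back Lie algebroid `h*F`, on the sections over an open subset -/

section PullbackAlgebroid

/-- The fibres of a pull-back bundle are additive groups. -/
instance pullbackAddCommGroup {B B' : Type*} (E : B → Type*) [∀ y, AddCommGroup (E y)]
    (f : B' → B) (x : B') : AddCommGroup ((f *ᵖ E) x) :=
  inferInstanceAs <| AddCommGroup (E (f x))

variable {m n : ℕ} {M N : Type*}
  [TopologicalSpace M] [ChartedSpace (EuclideanSpace ℝ (Fin m)) M] [IsManifold (𝓡 m) ∞ M]
  [TopologicalSpace N] [ChartedSpace (EuclideanSpace ℝ (Fin n)) N] [IsManifold (𝓡 n) ∞ N]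
  {p : ℕ} {F : N → Type*} [∀ y, AddCommGroup (F y)] [∀ y, Module ℝ (F y)]
  [∀ y, TopologicalSpace (F y)] [TopologicalSpace (TotalSpace (EuclideanSpace ℝ (Fin p)) F)]
  [FiberBundle (EuclideanSpace ℝ (Fin p)) F] [VectorBundle ℝ (EuclideanSpace ℝ (Fin p)) F]
  [ContMDiffVectorBundle ∞ (EuclideanSpace ℝ (Fin p)) F (𝓡 n)]
  {h : M ≃ₘ⟮𝓡 m, 𝓡 n⟯ N} {η : N ≃ₘ⟮𝓡 n, 𝓡 m⟯ M}

/-- The section `x ↦ u (h x)` over `U` of the pull-back bundle `h*F`. -/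
def pullbackSection (h : M ≃ₘ⟮𝓡 m, 𝓡 n⟯ N) (U : Opens M) (u : GlobalSection (n := n) p F) :
    localSections m p (h *ᵖ F) U :=
  ⟨fun x => u (h x), by
    refine (isSmoothSection_iff m p (h *ᵖ F) U _).2 fun x₀ => ?_
    have h1 := (contMDiffAt_section (h x₀)).1 (u.contMDiff (h x₀))
    exact ContMDiffAt.comp (f := fun x : U => h x)
      (g := fun y => (trivializationAt (EuclideanSpace ℝ (Fin p)) F (h x₀) ⟨y, u y⟩).2) x₀ h1
      ((h.contMDiff _).comp x₀ (contMDiff_subtype_val x₀))⟩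

/-- The global section `u` of `F` induces, near `x`, the section `S` of `h*F`. -/
def Induces {U : Opens M} (u : GlobalSection (n := n) p F)
    (S : localSections m p (h *ᵖ F) U) (x : U) : Prop :=
  ∀ᶠ z in 𝓝 x, S.1 z = (pullbackSection h U u).1 z

theorem exists_bump [T2Space N] (y : N) (s : Set N) (hs : s ∈ 𝓝 y) :
    ∃ φ : C^∞⟮𝓡 n, N; 𝓘(ℝ, ℝ), ℝ⟯, φ =ᶠ[𝓝 y] 1 ∧ tsupport φ ⊆ s := by
  obtain ⟨φ, -, hφ⟩ := (SmoothBumpFunction.nhds_basis_tsupport (I := 𝓡 n) y).mem_iff.1 hs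
  exact ⟨⟨φ, φ.contMDiff⟩, φ.eventuallyEq_one, hφ⟩

theorem t2Space (h : M ≃ₘ⟮𝓡 m, 𝓡 n⟯ N) [T2Space M] : T2Space N :=
  h.toHomeomorph.t2Space

theorem totalSpace_cast {y y' : N} (e : y = y') (w : F y) :
    (⟨y', e ▸ w⟩ : TotalSpace (EuclideanSpace ℝ (Fin p)) F) = ⟨y, w⟩ := by
  subst e; rfl

theorem exists_induces [T2Space M] {U : Opens M} (S : localSections m p (h *ᵖ F) U) (x : U) :
    ∃ u : GlobalSection (n := n) p F, Induces u S x := by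
  classical
  have : T2Space N := t2Space h
  let S' : ∀ z : M, F (h z) := fun z => if hz : z ∈ U then S.1 ⟨z, hz⟩ else 0
  have hS' : ∀ z : U, S' z = S.1 z := fun z => dif_pos z.2
  let s : ∀ y : N, F y := fun y => (h.apply_symm_apply y) ▸ S' (h.symm y)
  have hs : ∀ z : U, s (h z) = S.1 z := by
    intro z
    have key : ∀ (z' : M) (e : h z' = h z), z' = z → (e ▸ S' z' : F (h z)) = S.1 z := by
      intro z' e hz; subst hz; exact hS' z
    exact key _ _ (h.symm_apply_apply z)
  have hopen : IsOpen (h.symm ⁻¹' (U : Set M)) := U.isOpen.preimage h.symm.continuous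
  have hsm : ContMDiffOn (𝓡 n) ((𝓡 n).prod 𝓘(ℝ, EuclideanSpace ℝ (Fin p))) ∞
      (fun y => (⟨y, s y⟩ : TotalSpace (EuclideanSpace ℝ (Fin p)) F)) (h.symm ⁻¹' (U : Set M)) := by
    intro y hy
    refine ContMDiffAt.contMDiffWithinAt ?_
    rw [contMDiffAt_section]
    have h1 := (isSmoothSection_iff m p (h *ᵖ F) U S.1).1 S.2 ⟨h.symm y, hy⟩
    let G : M → EuclideanSpace ℝ (Fin p) := fun z =>
      (trivializationAt (EuclideanSpace ℝ (Fin p)) F (h (h.symm y)) ⟨h z, S' z⟩).2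
    have h2 : ContMDiffAt (𝓡 m) 𝓘(ℝ, EuclideanSpace ℝ (Fin p)) ∞ (fun z : U => G z)
        ⟨h.symm y, hy⟩ := by
      refine h1.congr_of_eventuallyEq (Filter.Eventually.of_forall fun z => ?_)
      change (trivializationAt (EuclideanSpace ℝ (Fin p)) F (h (h.symm y)) ⟨h z, S' z⟩).2 = _
      rw [hS']
      rfl
    rw [contMDiffAt_subtype_iff] at h2
    have h3 := h2.comp y (h.symm.contMDiff y)
    refine h3.congr_of_eventuallyEq (Filter.Eventually.of_forall fun y' => ?_)
    change (trivializationAt (EuclideanSpace ℝ (Fin p)) F y ⟨y', s y'⟩).2 =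
      (trivializationAt (EuclideanSpace ℝ (Fin p)) F (h (h.symm y))
        ⟨h (h.symm y'), S' (h.symm y')⟩).2
    rw [totalSpace_cast, h.apply_symm_apply y]
  obtain ⟨φ, hφ1, hφ2⟩ := exists_bump (n := n) (h x) (h.symm ⁻¹' (U : Set M))
    (hopen.mem_nhds (by simp))
  refine ⟨⟨fun y => φ y • s y,
    ContMDiffOn.smul_section_of_tsupport φ.contMDiff.contMDiffOn hopen hφ2 hsm⟩, ?_⟩
  have : ∀ᶠ z : U in 𝓝 x, φ (h z) = 1 :=
    (h.continuous.comp continuous_subtype_val).continuousAt.eventually hφ1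
  filter_upwards [this] with z hz
  change S.1 z = φ (h z) • s (h z)
  rw [hz, hs]
  exact (one_smul ℝ _).symm

namespace GeneralizedLieAlgebroid

variable (A : GeneralizedLieAlgebroid p F h η)

theorem bracket_zero (u) : A.bracket u 0 = 0 := by
  have := A.bracket_add u 0 0
  simpa using this

theorem bracket_skew (u v) : A.bracket u v = -A.bracket v u := by
  have := A.bracket_self (u + v)
  rw [A.bracket_add, A.add_bracket, A.add_bracket, A.bracket_self, A.bracket_self] at this
  rw [eq_neg_iff_add_eq_zero]
  simpa [add_comm] using this

theorem bracket_neg (u v) : A.bracket u (-v) = -A.bracket u v := by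
  rw [eq_neg_iff_add_eq_zero, ← A.bracket_add, neg_add_cancel, bracket_zero]

theorem bracket_eq_zero [T2Space N] (u v : GlobalSection (n := n) p F) (y : N)
    (hv : ∀ᶠ z in 𝓝 y, v z = 0) : A.bracket u v y = 0 := by
  obtain ⟨φ, hφ1, hφ2⟩ := exists_bump (n := n) y _ hv
  have h0 : mulSection φ v = 0 := by
    ext z
    change φ z • v z = 0
    by_cases hz : z ∈ tsupport φ
    · rw [show v z = 0 from hφ2 hz, smul_zero]
    · rw [image_eq_zero_of_notMem_tsupport hz, zero_smul]
  have := A.leibniz u v φ y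
  rw [h0, A.bracket_zero, hv.self_of_nhds, smul_zero, add_zero, hφ1.self_of_nhds] at this
  simpa using this.symm

theorem bracket_congr [T2Space N] {u u' v v' : GlobalSection (n := n) p F} {y : N}
    (hu : ∀ᶠ z in 𝓝 y, u z = u' z) (hv : ∀ᶠ z in 𝓝 y, v z = v' z) :
    A.bracket u v y = A.bracket u' v' y := by
  have h1 : ∀ a b b' : GlobalSection (n := n) p F, (∀ᶠ z in 𝓝 y, b z = b' z) →
      A.bracket a b y = A.bracket a b' y := by
    intro a b b' hb
    have := A.bracket_eq_zero a (b + -b') y (hb.mono fun z hz => by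
      change b z + -b' z = 0
      rw [hz, add_neg_cancel])
    rw [A.bracket_add, A.bracket_neg] at this
    exact sub_eq_zero.1 ((sub_eq_add_neg _ _).trans this)
  rw [h1 u v v' hv, A.bracket_skew u, A.bracket_skew u']
  exact congrArg Neg.neg (h1 v' u u' hu)

end GeneralizedLieAlgebroid

theorem Induces.eventually {U : Opens M} {u v : GlobalSection (n := n) p F}
    {S : localSections m p (h *ᵖ F) U} {x : U} (hu : Induces u S x) (hv : Induces v S x) :
    ∀ᶠ y in 𝓝 (h x), u y = v y := by
  have h1 : ∀ᶠ z : U in 𝓝 x, u (h z) = v (h z) := by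
    filter_upwards [hu, hv] with z hz hz' using hz.symm.trans hz'
  have h2 : ∀ᶠ z in 𝓝 (x : M), u (h z) = v (h z) := by
    rw [← U.isOpen.isOpenEmbedding_subtypeVal.map_nhds_eq x]
    exact h1
  have h3 : 𝓝 (h x) = Filter.map h (𝓝 (x : M)) := (h.toHomeomorph.map_nhds_eq x).symm
  rw [h3]
  exact h2

theorem exists_section_eq [T2Space N] (y : N) (w : F y) :
    ∃ v : GlobalSection (n := n) p F, v y = w := by
  obtain ⟨s, hs, hsm⟩ := FiberBundle.exists_contMDiffOn_extend (k := ∞) (𝓡 n)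
    (EuclideanSpace ℝ (Fin p)) w
  obtain ⟨φ, hφ1, hφ2⟩ := exists_bump (n := n) y (interior s) (interior_mem_nhds.2 hs)
  refine ⟨⟨fun z => φ z • FiberBundle.extend (EuclideanSpace ℝ (Fin p)) w z,
    ContMDiffOn.smul_section_of_tsupport φ.contMDiff.contMDiffOn isOpen_interior hφ2
      (hsm.mono interior_subset)⟩, ?_⟩
  change φ y • FiberBundle.extend (EuclideanSpace ℝ (Fin p)) w y = w
  rw [hφ1.self_of_nhds, FiberBundle.extend_apply_self]
  exact one_smul ℝ _

theorem exists_smooth_germ [T2Space M] {U : Opens M} (f : SmoothFun m U) (x : U) :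
    ∃ g : C^∞⟮𝓡 m, M; 𝓘(ℝ, ℝ), ℝ⟯, ∀ᶠ z in 𝓝 (x : M), Function.extend Subtype.val f 0 z = g z := by
  obtain ⟨φ, hφ1, hφ2⟩ := exists_bump (n := m) (x : M) (U : Set M) (U.isOpen.mem_nhds x.2)
  have hf : ∀ z : U, Function.extend Subtype.val f 0 (z : M) = f z :=
    fun z => Subtype.val_injective.extend_apply _ _ _
  refine ⟨⟨fun z => φ z • Function.extend Subtype.val f 0 z, ?_⟩, ?_⟩
  · refine contMDiff_of_tsupport fun z hz => ?_
    have hz' : z ∈ U := hφ2 (closure_mono (Function.support_smul_subset_left _ _) hz)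
    refine (φ.contMDiff z).smul ?_
    have := (contMDiffAt_subtype_iff (I := 𝓡 m) (I' := 𝓘(ℝ, ℝ)) (n := ∞)
      (f := Function.extend Subtype.val f 0) (x := (⟨z, hz'⟩ : U))).1
      (by simpa only [hf] using f.contMDiff ⟨z, hz'⟩)
    exact this
  · filter_upwards [hφ1] with z hz
    change _ = φ z • Function.extend Subtype.val f 0 z
    rw [hz]
    exact (one_smul ℝ _).symm

namespace GeneralizedLieAlgebroid

variable (A : GeneralizedLieAlgebroid p F h η)

/-- For a section `S` of `h*F` induced by the global section `u` of `F`, the derivative at `x` of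
the function `f` on `M` along the vector field `ρ ∘ u ∘ η⁻¹` on `M`, the image of `S` under the
anchor of the pull-back Lie algebroid `h*F`. -/
def pullbackAnchorDeriv (u : GlobalSection (n := n) p F) (f : M → ℝ) (x : M) : ℝ :=
  mfderiv (𝓡 m) 𝓘(ℝ, ℝ) f (η (η.symm x)) (A.ρ (η.symm x) (u (η.symm x)))

theorem anchorDeriv_eq (u : GlobalSection (n := n) p F) (g : C^∞⟮𝓡 n, N; 𝓘(ℝ, ℝ), ℝ⟯) (x : M) :
    anchorDeriv h η A.ρ u g (h x) = A.pullbackAnchorDeriv u (fun z => g (h z)) x := by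
  unfold anchorDeriv pullbackAnchorDeriv
  rw [h.symm_apply_apply]
  have h1 := mfderiv_comp (I := 𝓡 m) (I' := 𝓡 n) (I'' := 𝓘(ℝ, ℝ)) (η (η.symm x)) (g := g) (f := h)
    (g.contMDiff.mdifferentiable (by simp) _) (h.contMDiff.mdifferentiable (by simp) _)
  exact (congrArg (fun L => L (A.ρ (η.symm x) (u (η.symm x)))) h1).symm

theorem pullbackAnchorDeriv_eq_zero [T2Space M] {u : GlobalSection (n := n) p F} {x : M}
    (hu : ∀ᶠ y in 𝓝 (h x), u y = 0) (f : C^∞⟮𝓡 m, M; 𝓘(ℝ, ℝ), ℝ⟯) :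
    A.pullbackAnchorDeriv u f x = 0 := by
  have : T2Space N := t2Space h
  by_cases hp : ∃ w : F (h x), w ≠ 0
  · obtain ⟨w, hw⟩ := hp
    obtain ⟨v, hv⟩ := exists_section_eq (n := n) (p := p) (h x) w
    let g : C^∞⟮𝓡 n, N; 𝓘(ℝ, ℝ), ℝ⟯ := ⟨fun y => f (h.symm y), f.contMDiff.comp h.symm.contMDiff⟩
    have h0 : ∀ w : GlobalSection (n := n) p F, A.bracket u w (h x) = 0 := by
      intro w
      rw [A.bracket_skew]
      have := A.bracket_eq_zero w u (h x) hu
      change -(A.bracket w u (h x)) = 0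
      rw [this, neg_zero]
    have h1 := A.leibniz u v g (h x)
    rw [h0, h0, smul_zero, zero_add, A.anchorDeriv_eq, hv] at h1
    have h2 := (smul_eq_zero.1 h1.symm).resolve_right hw
    have h3 : (fun z => g (h z)) = f := funext fun z => congrArg f (h.symm_apply_apply z)
    rwa [h3] at h2
  · push Not at hp
    let e := (trivializationAt (EuclideanSpace ℝ (Fin p)) F (h x)).continuousLinearEquivAt ℝ (h x)
      (mem_baseSet_trivializationAt _ F _)
    let e' := (trivializationAt (EuclideanSpace ℝ (Fin p)) F (η.symm x)).continuousLinearEquivAt ℝ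
      (η.symm x) (mem_baseSet_trivializationAt _ F _)
    have h1 : u (η.symm x) = 0 := by
      have h2 := hp (e.symm (e' (u (η.symm x))))
      rwa [map_eq_zero_iff _ e.symm.injective, map_eq_zero_iff _ e'.injective] at h2
    unfold pullbackAnchorDeriv
    rw [h1, map_zero, map_zero]
    rfl

theorem pullbackAnchorDeriv_congr [T2Space M] {u v : GlobalSection (n := n) p F} {x : M}
    (huv : ∀ᶠ y in 𝓝 (h x), u y = v y) {f g : M → ℝ} (hfg : f =ᶠ[𝓝 x] g)
    (hg : ContMDiff (𝓡 m) 𝓘(ℝ, ℝ) ∞ g) :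
    A.pullbackAnchorDeriv u f x = A.pullbackAnchorDeriv v g x := by
  have h1 := A.pullbackAnchorDeriv_eq_zero (u := u - v) (x := x) (huv.mono fun y hy => by
      change u y - v y = 0
      rw [hy, sub_self]) ⟨g, hg⟩
  have h2 : mfderiv (𝓡 m) 𝓘(ℝ, ℝ) f (η (η.symm x)) = mfderiv (𝓡 m) 𝓘(ℝ, ℝ) g (η (η.symm x)) :=
    Filter.EventuallyEq.mfderiv_eq (by rwa [η.apply_symm_apply])
  have h3 : A.pullbackAnchorDeriv u f x = A.pullbackAnchorDeriv u g x :=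
    congrArg (fun L : EuclideanSpace ℝ (Fin m) →L[ℝ] ℝ => L (A.ρ (η.symm x) (u (η.symm x)))) h2
  have h4 : A.pullbackAnchorDeriv (u - v) g x =
      A.pullbackAnchorDeriv u g x - A.pullbackAnchorDeriv v g x := by
    have h5 : A.ρ (η.symm x) ((u - v) (η.symm x)) =
        A.ρ (η.symm x) (u (η.symm x)) - A.ρ (η.symm x) (v (η.symm x)) := map_sub _ _ _
    exact (congrArg (mfderiv (𝓡 m) 𝓘(ℝ, ℝ) g (η (η.symm x))) h5).trans (map_sub _ _ _)
  rw [h3]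
  exact sub_eq_zero.1 (h4.symm.trans h1)

theorem contMDiff_pullbackAnchorDeriv (u : GlobalSection (n := n) p F)
    (g : C^∞⟮𝓡 m, M; 𝓘(ℝ, ℝ), ℝ⟯) :
    ContMDiff (𝓡 m) 𝓘(ℝ, ℝ) ∞ (A.pullbackAnchorDeriv u g) := by
  have h1 := g.contMDiff.contMDiff_tangentMap (m := ∞) (by simp)
  have h2 := (contMDiff_snd_tangentBundle_modelSpace ℝ 𝓘(ℝ, ℝ) (n := ∞)).comp
    (h1.comp (A.contMDiff_ρ.comp (u.contMDiff.comp η.symm.contMDiff)))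
  exact h2

/-- The value at `x` of the bracket of the sections `S`, `T` over `U` of `h*F`: the bracket of two
global sections of `F` which induce `S` and `T` near `x`. -/
def bracketAt [T2Space M] {U : Opens M} (S T : localSections m p (h *ᵖ F) U) (x : U) :
    (h *ᵖ F) (x : M) :=
  (pullbackSection h U
    (A.bracket (exists_induces S x).choose (exists_induces T x).choose)).1 x

theorem bracketAt_eq [T2Space M] {U : Opens M} {u v : GlobalSection (n := n) p F}
    {S T : localSections m p (h *ᵖ F) U} {x : U} (hu : Induces u S x) (hv : Induces v T x) :
    A.bracketAt S T x = (pullbackSection h U (A.bracket u v)).1 x := by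
  have : T2Space N := t2Space h
  exact A.bracket_congr (Induces.eventually (exists_induces S x).choose_spec hu)
    (Induces.eventually (exists_induces T x).choose_spec hv)

/-- The bracket of the pull-back Lie algebroid `h*F` on the sections over `U`. -/
def localBracket [T2Space M] (U : Opens M) (S T : localSections m p (h *ᵖ F) U) :
    localSections m p (h *ᵖ F) U :=
  ⟨fun x => A.bracketAt S T x, by
    intro x
    obtain ⟨u, hu⟩ := exists_induces S x
    obtain ⟨v, hv⟩ := exists_induces T x
    refine ((pullbackSection h U (A.bracket u v)).2 x).congr_of_eventuallyEq ?_
    filter_upwards [hu.eventually_nhds, hv.eventually_nhds] with z hz hz'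
    rw [A.bracketAt_eq hz hz']⟩

/-- The action of a section `S` over `U` of the pull-back Lie algebroid `h*F` on a smooth function
`f` on `U`, through the anchor of `h*F`. -/
def localAnchor [T2Space M] (U : Opens M) (S : localSections m p (h *ᵖ F) U) (f : SmoothFun m U) :
    SmoothFun m U :=
  ⟨fun x => A.pullbackAnchorDeriv (exists_induces S x).choose (Function.extend Subtype.val f 0) x,
    by
    intro x
    obtain ⟨u, hu⟩ := exists_induces S x
    obtain ⟨g, hg⟩ := exists_smooth_germ f x
    have h1 : ContMDiffAt (𝓡 m) 𝓘(ℝ, ℝ) ∞ (fun z : U => A.pullbackAnchorDeriv u g z) x :=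
      contMDiffAt_subtype_iff.2 (A.contMDiff_pullbackAnchorDeriv u g x)
    refine h1.congr_of_eventuallyEq ?_
    filter_upwards [hu.eventually_nhds,
      continuous_subtype_val.continuousAt.eventually hg.eventually_nhds] with z hz hz'
    exact A.pullbackAnchorDeriv_congr
      (Induces.eventually (exists_induces S z).choose_spec hz) hz' g.contMDiff⟩

theorem localBracket_apply [T2Space M] {U : Opens M} {u v : GlobalSection (n := n) p F}
    {S T : localSections m p (h *ᵖ F) U} {x : U} (hu : Induces u S x) (hv : Induces v T x) :
    (A.localBracket U S T).1 x = (pullbackSection h U (A.bracket u v)).1 x :=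
  A.bracketAt_eq hu hv

theorem localAnchor_apply [T2Space M] {U : Opens M} {u : GlobalSection (n := n) p F}
    {S : localSections m p (h *ᵖ F) U} {f : SmoothFun m U} {g : M → ℝ} {x : U}
    (hu : Induces u S x) (hg : ContMDiff (𝓡 m) 𝓘(ℝ, ℝ) ∞ g)
    (hfg : Function.extend Subtype.val f 0 =ᶠ[𝓝 (x : M)] g) :
    A.localAnchor U S f x = A.pullbackAnchorDeriv u g x :=
  A.pullbackAnchorDeriv_congr (Induces.eventually (exists_induces S x).choose_spec hu) hfg hg

/-- The differential of a `1`-form over `U` of the pull-back Lie algebroid `h*F`, as a `2`-form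
(a function of two sections over `U`):
`dθ (S, T) = ρ(S) (θ T) - ρ(T) (θ S) - θ [S, T]`. -/
def extDeriv [T2Space M] (U : Opens M) (θ : OneForm m p (h *ᵖ F) U)
    (S T : localSections m p (h *ᵖ F) U) : SmoothFun m U :=
  A.localAnchor U S (θ T) - A.localAnchor U T (θ S) - θ (A.localBracket U S T)

/-- The vector subbundle `E` of `h*F` (an interior differential system) is involutive:
`[S, T] ∈ Γ(E)` for all global sections `S, T ∈ Γ(E)`. -/
def Involutive [T2Space M] {r : ℕ} (E : VectorSubbundle m p (h *ᵖ F) r) : Prop :=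
  ∀ S ∈ E.sections ⊤, ∀ T ∈ E.sections ⊤, A.localBracket ⊤ S T ∈ E.sections ⊤

end GeneralizedLieAlgebroid
end PullbackAlgebroid

end

end GenLie

/-! Over a chart domain `U` the differential dθ is a skew form, bilinear over the smooth functions:
the Leibniz rule of the pull-back bracket cancels the derivative terms. If θ vanishes on S and T,
then dθ(S, T) = -θ([S, T]). Hence, once Γ(E|U) is known to be the common kernel of the Θ^α, it is
closed under the bracket exactly when every dΘ^α vanishes on pairs of elements of that kernel. A
skew form in the ideal of the Θ^β clearly vanishes on such pairs. The converse
(`exists_eq_sum_wedge`) is linear algebra over a ring in which 2 is invertible, given sections e_β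
dual to the Θ^α. The dual sections (`exists_dual_family`) and the description of Γ(E|U) as a common
kernel (`mem_of_forall_basis_eq_zero`) both follow from Γ(E|U) being complemented in the finite free
module Γ(h*F|U). The complement (`VectorSubbundle.exists_projection`) comes from orthogonal
projection in the coordinates of a frame. Bracket and anchor depend only on germs, and cut-off
functions turn sections of E over `U` into global ones without changing a given germ. So
involutivity, a condition on global sections, can be tested on the chart domains. -/

namespace GenLie

/-! ### Linear algebra over a commutative ring: skew forms, annihilators and dual families. -/

section Algebra

variable {R Γ ι κ : Type*} [CommRing R] [AddCommGroup Γ] [Module R Γ]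

/-- A skew bilinear form which vanishes on the common kernel of the forms `Θ β` lies in the ideal
generated by them, provided that they have a dual family. -/
theorem exists_eq_sum_wedge [Fintype ι] [DecidableEq ι] (B : Γ →ₗ[R] Γ →ₗ[R] R)
    (hskew : ∀ S T, B S T = -B T S)
    (Θ : ι → Module.Dual R Γ) (e : ι → Γ) (he : ∀ α β, Θ α (e β) = if α = β then 1 else 0)
    (hB : ∀ S T, (∀ α, Θ α S = 0) → (∀ α, Θ α T = 0) → B S T = 0) (c : R) (hc : c + c = 1) :
    ∃ Ω : ι → Module.Dual R Γ, ∀ S T, B S T = ∑ β, (Ω β S * Θ β T - Ω β T * Θ β S) := by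
  -- Expanding B = 0 on the kernel components of S and T gives B(S, T) as the wedges of B(·, e_β)
  -- with Θ^β, minus a double sum in the B(e_γ, e_β). The double sum is skew, so wedging counts it
  -- twice; the factor `c`, one half, compensates.
  refine ⟨fun β => B.flip (e β) - c • ∑ γ, B (e γ) (e β) • Θ γ, fun S T => ?_⟩
  have hker : ∀ S α, Θ α (S - ∑ β, Θ β S • e β) = 0 := by
    intro S α
    simp [he]
  have h0 := hB _ _ (hker S) (hker T)
  have h1 : ∑ γ, Θ γ S * B (e γ) T = -∑ γ, B T (e γ) * Θ γ S := by
    rw [← Finset.sum_neg_distrib]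
    exact Finset.sum_congr rfl fun γ _ => by rw [hskew (e γ) T]; ring
  have h2 : ∑ β, (∑ γ, B (e γ) (e β) * Θ γ T) * Θ β S =
      -∑ β, (∑ γ, B (e γ) (e β) * Θ γ S) * Θ β T := by
    simp_rw [Finset.sum_mul]
    rw [Finset.sum_comm, ← Finset.sum_neg_distrib]
    refine Finset.sum_congr rfl fun γ _ => ?_
    rw [← Finset.sum_neg_distrib]
    refine Finset.sum_congr rfl fun β _ => ?_
    rw [hskew (e γ) (e β)]; ring
  have h3 : ∑ β, Θ β T * ∑ γ, Θ γ S * B (e γ) (e β) =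
      ∑ β, (∑ γ, B (e γ) (e β) * Θ γ S) * Θ β T := by
    refine Finset.sum_congr rfl fun β _ => ?_
    rw [mul_comm]
    exact congrArg (· * Θ β T) (Finset.sum_congr rfl fun γ _ => mul_comm _ _)
  have h4 : ∑ β, Θ β T * B S (e β) = ∑ β, B S (e β) * Θ β T :=
    Finset.sum_congr rfl fun γ _ => mul_comm _ _
  simp only [map_sub, map_sum, map_smul, LinearMap.sub_apply, LinearMap.sum_apply,
    LinearMap.smul_apply, smul_eq_mul, Finset.mul_sum, Finset.sum_sub_distrib, mul_sub] at h0
  simp only [← Finset.mul_sum] at h0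
  rw [h1, h3, h4] at h0
  simp only [LinearMap.sub_apply, LinearMap.smul_apply, LinearMap.sum_apply, LinearMap.flip_apply,
    smul_eq_mul, sub_mul, Finset.sum_sub_distrib, mul_assoc]
  rw [← Finset.mul_sum, ← Finset.mul_sum, h2]
  linear_combination h0 + (∑ β, (∑ γ, B (e γ) (e β) * Θ γ S) * Θ β T) * hc

variable {E : Submodule R Γ}

/-- If the submodule `E` of a free module is complemented, then a basis of its annihilator has a
dual family. -/
theorem exists_dual_family [Fintype κ] [DecidableEq ι] (t : Module.Basis κ R Γ) (P : Γ →ₗ[R] Γ)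
    (hP : ∀ S ∈ E, P S = 0) (hP' : ∀ S, S - P S ∈ E) (Θ : Module.Basis ι R E.dualAnnihilator) :
    ∃ e : ι → Γ, ∀ α β, (Θ α).1 (e β) = if α = β then 1 else 0 := by
  -- Composition with `P` is a retraction of the whole dual onto the annihilator, so the coordinates
  -- with respect to `Θ` extend to linear functions on the dual of Γ.
  let Q : Module.Dual R Γ →ₗ[R] E.dualAnnihilator :=
    (P.dualMap).codRestrict _ fun θ => (Submodule.mem_dualAnnihilator _).2 fun S hS => by
      rw [LinearMap.dualMap_apply, hP S hS, map_zero]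
  have hQ : ∀ θ : E.dualAnnihilator, Q θ.1 = θ := fun θ => Subtype.ext <| LinearMap.ext fun S => by
    have := (Submodule.mem_dualAnnihilator _).1 θ.2 _ (hP' S)
    rw [map_sub, sub_eq_zero] at this
    exact this.symm
  -- A finite free module is reflexive: this vector represents the functional `Θ.coord β ∘ Q` on the
  -- dual, since evaluating θ at it gives `Θ.coord β (Q θ)`.
  refine ⟨fun β => ∑ a, Θ.coord β (Q (t.coord a)) • t a, fun α β => ?_⟩
  have h1 : (Θ α).1 = ∑ a, (Θ α).1 (t a) • t.coord a := by
    refine t.ext fun b => ?_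
    classical
    simp
  have h2 : Θ.coord β (Q (Θ α).1) = if α = β then 1 else 0 := by
    rw [hQ, Module.Basis.coord_apply, Module.Basis.repr_self, Finsupp.single_apply]
  rw [← h2]
  conv_rhs => rw [h1]
  simp only [map_sum, map_smul, smul_eq_mul]
  exact Finset.sum_congr rfl fun a _ => mul_comm _ _

/-- A complemented submodule of a free module is the common kernel of a basis of its
annihilator. -/
theorem mem_of_forall_basis_eq_zero [Fintype ι] (t : Module.Basis κ R Γ) (P : Γ →ₗ[R] Γ)
    (hP : ∀ S ∈ E, P S = 0) (hP' : ∀ S, S - P S ∈ E) (Θ : Module.Basis ι R E.dualAnnihilator)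
    (S : Γ) (hS : ∀ α, (Θ α).1 S = 0) : S ∈ E := by
  have h1 : ∀ θ : E.dualAnnihilator, θ.1 S = 0 := by
    intro θ
    rw [← Θ.sum_repr θ]
    simp only [Submodule.coe_sum, Submodule.coe_smul, LinearMap.sum_apply, LinearMap.smul_apply, hS,
      smul_zero, Finset.sum_const_zero]
  have h2 : P S = 0 := by
    rw [← t.forall_coord_eq_zero_iff]
    intro a
    -- Each coordinate of `P S` is the value at `S` of a form that annihilates `E`.
    exact h1 ⟨(t.coord a).comp P, (Submodule.mem_dualAnnihilator _).2 fun T hT => by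
      rw [LinearMap.comp_apply, hP T hT, map_zero]⟩
  have := hP' S
  rwa [h2, sub_zero] at this

end Algebra

/-! ### Smooth dependence of orthogonal projections and coefficients on the vectors. -/

noncomputable section

section Projection

variable {m : ℕ} {M : Type*} [TopologicalSpace M] [ChartedSpace (EuclideanSpace ℝ (Fin m)) M]
  {V : Type*} [NormedAddCommGroup V] [InnerProductSpace ℝ V] {x₀ : M}

/-- This is the projection onto the line of `v x`, the building block of the Gram–Schmidt process.
-/
theorem ContMDiffAt.inner_div_smul {v w : M → V} (hv : ContMDiffAt (𝓡 m) 𝓘(ℝ, V) ∞ v x₀)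
    (hw : ContMDiffAt (𝓡 m) 𝓘(ℝ, V) ∞ w x₀) (h0 : v x₀ ≠ 0) :
    ContMDiffAt (𝓡 m) 𝓘(ℝ, V) ∞ (fun x => (inner ℝ (v x) (w x) / ‖v x‖ ^ 2) • v x) x₀ := by
  have h1 : ContMDiffAt (𝓡 m) 𝓘(ℝ, ℝ) ∞ (fun x => inner ℝ (v x) (w x)) x₀ :=
    (contDiff_inner (𝕜 := ℝ)).contMDiff.contMDiffAt.comp x₀ (hv.prodMk_space hw)
  have h2 : ContMDiffAt (𝓡 m) 𝓘(ℝ, ℝ) ∞ (fun x => ‖v x‖ ^ 2) x₀ :=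
    (contDiff_norm_sq ℝ).contMDiff.contMDiffAt.comp x₀ hv
  exact (h1.div₀ h2 (by simpa using h0)).smul hv

/-- Each step of the recursion subtracts projections onto the lines of earlier vectors. Independence
at `x₀` keeps those vectors nonzero there, so the denominators cause no trouble. -/
theorem contMDiffAt_gramSchmidt {r : ℕ} {f : Fin r → M → V}
    (hf : ∀ i, ContMDiffAt (𝓡 m) 𝓘(ℝ, V) ∞ (f i) x₀)
    (hli : LinearIndependent ℝ fun i => f i x₀) (i : Fin r) :
    ContMDiffAt (𝓡 m) 𝓘(ℝ, V) ∞
      (fun x => InnerProductSpace.gramSchmidt ℝ (fun j => f j x) i) x₀ := by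
  induction i using WellFoundedLT.induction with
  | _ i ih =>
    have h1 : ∀ x, InnerProductSpace.gramSchmidt ℝ (fun j => f j x) i = f i x -
        ∑ j ∈ Finset.Iio i, (inner ℝ (InnerProductSpace.gramSchmidt ℝ (fun j => f j x) j) (f i x) /
          ‖InnerProductSpace.gramSchmidt ℝ (fun j => f j x) j‖ ^ 2) •
            InnerProductSpace.gramSchmidt ℝ (fun j => f j x) j := by
      intro x
      rw [InnerProductSpace.gramSchmidt_def]
      simp only [Submodule.starProjection_singleton]
      rfl
    simp_rw [h1]
    refine (hf i).sub (ContMDiffAt.sum fun j hj => ?_)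
    exact ContMDiffAt.inner_div_smul (ih j (Finset.mem_Iio.1 hj)) (hf i)
      (InnerProductSpace.gramSchmidt_ne_zero j hli)

/-- The orthogonal projection onto the span of finitely many independent vectors depends smoothly
on them. -/
theorem contMDiffAt_starProjection_span {ι : Type*} [Fintype ι] [FiniteDimensional ℝ V]
    {f : ι → M → V} (hf : ∀ i, ContMDiffAt (𝓡 m) 𝓘(ℝ, V) ∞ (f i) x₀)
    (hli : ∀ᶠ x in 𝓝 x₀, LinearIndependent ℝ fun i => f i x) {w : M → V}
    (hw : ContMDiffAt (𝓡 m) 𝓘(ℝ, V) ∞ w x₀) :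
    ContMDiffAt (𝓡 m) 𝓘(ℝ, V) ∞
      (fun x => (Submodule.span ℝ (range fun i => f i x)).starProjection (w x)) x₀ := by
  -- Gram–Schmidt needs an ordered index set. The orthogonal family has the same span, and the
  -- projection onto it is the sum of the projections onto its lines.
  let ε := (Fintype.equivFin ι).symm
  let g : M → Fin (Fintype.card ι) → V := fun x =>
    InnerProductSpace.gramSchmidt ℝ (fun j => f (ε j) x)
  have hli' : ∀ᶠ x in 𝓝 x₀, LinearIndependent ℝ fun j => f (ε j) x :=
    hli.mono fun x hx => hx.comp ε ε.injective
  have hg : ∀ j, ContMDiffAt (𝓡 m) 𝓘(ℝ, V) ∞ (fun x => g x j) x₀ :=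
    contMDiffAt_gramSchmidt (fun j => hf (ε j)) hli'.self_of_nhds
  have h1 : ContMDiffAt (𝓡 m) 𝓘(ℝ, V) ∞
      (fun x => ∑ j, (inner ℝ (g x j) (w x) / ‖g x j‖ ^ 2) • g x j) x₀ :=
    ContMDiffAt.sum fun j _ => ContMDiffAt.inner_div_smul (hg j) hw
      (InnerProductSpace.gramSchmidt_ne_zero j hli'.self_of_nhds)
  refine h1.congr_of_eventuallyEq ?_
  filter_upwards [hli'] with x hx
  have hspan : Submodule.span ℝ (range fun i => f i x) = Submodule.span ℝ (range (g x)) := by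
    rw [InnerProductSpace.span_gramSchmidt]
    exact congrArg _ (ε.surjective.range_comp (fun i => f i x)).symm
  rw [hspan]
  refine Submodule.eq_starProjection_of_mem_of_inner_eq_zero
    (Submodule.sum_mem _ fun j _ => Submodule.smul_mem _ _ (Submodule.subset_span ⟨j, rfl⟩)) ?_
  intro v hv
  induction hv using Submodule.span_induction with
  | mem v hv =>
    obtain ⟨j, rfl⟩ := hv
    have h0 : g x j ≠ 0 := InnerProductSpace.gramSchmidt_ne_zero j hx
    rw [inner_sub_left, sum_inner, Finset.sum_eq_single j, inner_smul_left, real_inner_self_eq_norm_sq]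
    · rw [real_inner_comm (w x)]
      have : ‖g x j‖ ≠ 0 := norm_ne_zero_iff.2 h0
      simp [this]
    · intro k _ hk
      rw [inner_smul_left, InnerProductSpace.gramSchmidt_orthogonal ℝ _ hk, mul_zero]
    · simp
  | zero => simp
  | add v v' _ _ h h' => rw [inner_add_right, h, h', add_zero]
  | smul a v _ h => rw [inner_smul_right, h, mul_zero]

/-- The coefficients of a smooth map in a smooth family of independent vectors are smooth. -/
theorem contMDiffAt_coeff {ι : Type*} [Fintype ι] [FiniteDimensional ℝ V]
    {f : ι → M → V} (hf : ∀ i, ContMDiffAt (𝓡 m) 𝓘(ℝ, V) ∞ (f i) x₀)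
    (hli : ∀ᶠ x in 𝓝 x₀, LinearIndependent ℝ fun i => f i x) {c : ι → M → ℝ}
    (hw : ContMDiffAt (𝓡 m) 𝓘(ℝ, V) ∞ (fun x => ∑ i, c i x • f i x) x₀) (i : ι) :
    ContMDiffAt (𝓡 m) 𝓘(ℝ, ℝ) ∞ (c i) x₀ := by
  classical
  let K : M → Submodule ℝ V := fun x => Submodule.span ℝ (range fun j : {j // j ≠ i} => f j x)
  -- The component of `f i` orthogonal to the other vectors isolates the coefficient: pairing the
  -- sum with `n` gives c_i = ⟨n, w⟩ / ⟨n, f_i⟩. The denominator equals ‖n‖², which vanishes only if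
  -- `f i` lies in the span of the others.
  let n : M → V := fun x => f i x - (K x).starProjection (f i x)
  have hn : ContMDiffAt (𝓡 m) 𝓘(ℝ, V) ∞ n x₀ :=
    (hf i).sub (contMDiffAt_starProjection_span (f := fun j : {j // j ≠ i} => f j) (fun j => hf j)
      (hli.mono fun x hx => hx.comp Subtype.val Subtype.val_injective) (hf i))
  have hnK : ∀ x, n x ∈ (K x)ᗮ := fun x => Submodule.sub_starProjection_mem_orthogonal _
  have hinner : ∀ {v w : M → V}, ContMDiffAt (𝓡 m) 𝓘(ℝ, V) ∞ v x₀ →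
      ContMDiffAt (𝓡 m) 𝓘(ℝ, V) ∞ w x₀ →
      ContMDiffAt (𝓡 m) 𝓘(ℝ, ℝ) ∞ (fun x => inner ℝ (v x) (w x)) x₀ := fun hv hw =>
    (contDiff_inner (𝕜 := ℝ)).contMDiff.contMDiffAt.comp x₀ (hv.prodMk_space hw)
  have h0 : ∀ᶠ x in 𝓝 x₀, inner ℝ (n x) (f i x) ≠ 0 := by
    filter_upwards [hli] with x hx h0
    have h1 : inner ℝ (n x) (n x) = 0 := by
      change inner ℝ (n x) (f i x - _) = (0 : ℝ)
      rw [inner_sub_right, h0, zero_sub, neg_eq_zero]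
      exact Submodule.inner_left_of_mem_orthogonal (Submodule.starProjection_apply_mem _ _) (hnK x)
    have h2 : f i x ∈ K x := by
      rw [sub_eq_zero.1 (inner_self_eq_zero.1 h1)]
      exact Submodule.starProjection_apply_mem _ _
    have h3 : K x = Submodule.span ℝ ((fun j => f j x) '' {j | j ≠ i}) := by
      rw [Set.image_eq_range]; rfl
    rw [h3] at h2
    exact hx.notMem_span_image (s := {j | j ≠ i}) (fun hi => hi rfl) h2
  refine ((hinner hn hw).div₀ (hinner hn (hf i)) h0.self_of_nhds).congr_of_eventuallyEq ?_
  filter_upwards [h0] with x hx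
  rw [Pi.div_apply, eq_div_iff hx, inner_sum, Finset.sum_eq_single i, inner_smul_right]
  · intro j _ hj
    rw [inner_smul_right, Submodule.inner_left_of_mem_orthogonal (K := K x) _ (hnK x), mul_zero]
    exact Submodule.subset_span ⟨⟨j, hj⟩, rfl⟩
  · simp

end Projection

end

/-! ### Frames, coordinates, and a complement of the sections of a subbundle. -/

noncomputable section

section Frame

variable {m : ℕ} {M : Type*} [TopologicalSpace M] [ChartedSpace (EuclideanSpace ℝ (Fin m)) M]
  {p : ℕ} {W : M → Type*} [∀ x, AddCommGroup (W x)] [∀ x, Module ℝ (W x)]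
  [∀ x, TopologicalSpace (W x)] [TopologicalSpace (TotalSpace (EuclideanSpace ℝ (Fin p)) W)]
  [FiberBundle (EuclideanSpace ℝ (Fin p)) W] [VectorBundle ℝ (EuclideanSpace ℝ (Fin p)) W]
  {U : Opens M}

/-- The linear equivalence from a fibre to the model fibre given by a bundle chart. -/
def fiberEquiv (x₀ x : M)
    (hx : x ∈ (trivializationAt (EuclideanSpace ℝ (Fin p)) W x₀).baseSet) :
    W x ≃ₗ[ℝ] EuclideanSpace ℝ (Fin p) :=
  ((trivializationAt (EuclideanSpace ℝ (Fin p)) W x₀).continuousLinearEquivAt ℝ x hx).toLinearEquiv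

theorem sum_smul_apply {ι : Type*} [Fintype ι] (f : ι → SmoothFun m U)
    (s : ι → localSections m p W U) (x : U) :
    (∑ i, f i • s i).1 x = ∑ i, f i x • (s i).1 x := by
  rw [AddSubgroup.val_finsetSum, Finset.sum_apply]
  rfl

/-- The basis of the fibre over `x` given by a frame. -/
def frameBasisAt (t : Fin p → localSections m p W U)
    (ht : ∀ x : U, LinearIndependent ℝ fun a => (t a).1 x) (x : U) :
    Module.Basis (Fin p) ℝ (W x) :=
  Module.Basis.mk (ht x) <| by
    have e := fiberEquiv (p := p) (x : M) (x : M) (mem_baseSet_trivializationAt _ W _)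
    have : FiniteDimensional ℝ (W x) := e.symm.finiteDimensional
    refine ((ht x).span_eq_top_of_card_eq_finrank' ?_).ge
    rw [e.finrank_eq, finrank_euclideanSpace]

theorem frameBasisAt_apply (t : Fin p → localSections m p W U)
    (ht : ∀ x : U, LinearIndependent ℝ fun a => (t a).1 x) (x : U) (a : Fin p) :
    frameBasisAt t ht x a = (t a).1 x :=
  Module.Basis.mk_apply _ _ _

/-- The coordinates in a frame of a section which is smooth at a point are smooth there. -/
theorem contMDiffAt_frameBasisAt_repr (t : Fin p → localSections m p W U)
    (ht : ∀ x : U, LinearIndependent ℝ fun a => (t a).1 x) (x₀ : U) {w : ∀ x : U, W x}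
    (hw : ContMDiffAt (𝓡 m) 𝓘(ℝ, EuclideanSpace ℝ (Fin p)) ∞
      (fun x : U => (trivializationAt (EuclideanSpace ℝ (Fin p)) W (x₀ : M) ⟨(x : M), w x⟩).2) x₀)
    (a : Fin p) :
    ContMDiffAt (𝓡 m) 𝓘(ℝ, ℝ) ∞ (fun x : U => (frameBasisAt t ht x).repr (w x) a) x₀ := by
  refine contMDiffAt_coeff (c := fun a x => (frameBasisAt t ht x).repr (w x) a)
    (f := fun a (x : U) => (trivializationAt (EuclideanSpace ℝ (Fin p)) W (x₀ : M)
      ⟨(x : M), (t a).1 x⟩).2)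
    (fun b => (isSmoothSection_iff m p W U _).1 (t b).2 x₀) ?_ ?_ a
  · filter_upwards [eventually_mem_baseSet p W U x₀] with x hx
    exact (ht x).map' (fiberEquiv (x₀ : M) (x : M) hx).toLinearMap (LinearEquiv.ker _)
  · refine hw.congr_of_eventuallyEq ?_
    filter_upwards [eventually_mem_baseSet p W U x₀] with x hx
    have h1 := congrArg (fiberEquiv (x₀ : M) (x : M) hx) ((frameBasisAt t ht x).sum_repr (w x))
    rw [map_sum] at h1
    simp only [map_smul, frameBasisAt_apply] at h1
    exact h1

/-- A frame over `U` is a basis of the module of sections over `U`. -/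
def frameBasis (t : Fin p → localSections m p W U)
    (ht : ∀ x : U, LinearIndependent ℝ fun a => (t a).1 x) :
    Module.Basis (Fin p) (SmoothFun m U) (localSections m p W U) :=
  Module.Basis.mk (v := t)
    (by
      rw [Fintype.linearIndependent_iff]
      intro f hf a
      ext x
      have h1 := congrFun (congrArg Subtype.val hf) x
      rw [sum_smul_apply] at h1
      exact Fintype.linearIndependent_iff.1 (ht x) (fun a => f a x) h1 a)
    (by
      intro s _
      let c : Fin p → SmoothFun m U := fun a =>
        ⟨fun x => (frameBasisAt t ht x).repr (s.1 x) a, fun x₀ =>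
          contMDiffAt_frameBasisAt_repr t ht x₀ ((isSmoothSection_iff m p W U _).1 s.2 x₀) a⟩
      have h1 : s = ∑ a, c a • t a := by
        refine Subtype.ext (funext fun x => ?_)
        rw [sum_smul_apply]
        refine ((frameBasisAt t ht x).sum_repr (s.1 x)).symm.trans ?_
        exact Finset.sum_congr rfl fun a _ => by rw [frameBasisAt_apply]; rfl
      rw [h1]
      exact Submodule.sum_mem _ fun a _ => Submodule.smul_mem _ _ (Submodule.subset_span ⟨a, rfl⟩))

/-- The linear equivalence from the coordinate space to the fibre over `x` given by a frame. -/
def frameEquiv (t : Fin p → localSections m p W U)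
    (ht : ∀ x : U, LinearIndependent ℝ fun a => (t a).1 x) (x : U) :
    EuclideanSpace ℝ (Fin p) ≃ₗ[ℝ] W x :=
  (WithLp.linearEquiv 2 ℝ (Fin p → ℝ)).trans (frameBasisAt t ht x).equivFun.symm

theorem frameEquiv_apply (t : Fin p → localSections m p W U)
    (ht : ∀ x : U, LinearIndependent ℝ fun a => (t a).1 x) (x : U)
    (v : EuclideanSpace ℝ (Fin p)) : frameEquiv t ht x v = ∑ a, v a • (t a).1 x := by
  change (frameBasisAt t ht x).equivFun.symm v = _
  rw [Module.Basis.equivFun_symm_apply]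
  simp only [frameBasisAt_apply]

theorem contMDiffAt_frameEquiv_symm (t : Fin p → localSections m p W U)
    (ht : ∀ x : U, LinearIndependent ℝ fun a => (t a).1 x) (x₀ : U) {w : ∀ x : U, W x}
    (hw : ContMDiffAt (𝓡 m) 𝓘(ℝ, EuclideanSpace ℝ (Fin p)) ∞
      (fun x : U => (trivializationAt (EuclideanSpace ℝ (Fin p)) W (x₀ : M) ⟨(x : M), w x⟩).2)
      x₀) :
    ContMDiffAt (𝓡 m) 𝓘(ℝ, EuclideanSpace ℝ (Fin p)) ∞
      (fun x : U => (frameEquiv t ht x).symm (w x)) x₀ := by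
  have h1 : ContMDiffAt (𝓡 m) 𝓘(ℝ, Fin p → ℝ) ∞
      (fun x : U => fun a => (frameBasisAt t ht x).repr (w x) a) x₀ :=
    contMDiffAt_pi_space.2 fun a => contMDiffAt_frameBasisAt_repr t ht x₀ hw a
  exact (EuclideanSpace.equiv (Fin p) ℝ).symm.contDiff.contMDiff.contMDiffAt.comp x₀ h1

variable {r : ℕ}

/-- The coordinate space of the fibre of a subbundle, in a frame. -/
def VectorSubbundle.coordFiber (E : VectorSubbundle m p W r) (t : Fin p → localSections m p W U)
    (ht : ∀ x : U, LinearIndependent ℝ fun a => (t a).1 x) (x : U) :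
    Submodule ℝ (EuclideanSpace ℝ (Fin p)) :=
  (E.fiber x).comap (frameEquiv t ht x).toLinearMap

/-- The orthogonal projection onto the coordinate space of a subbundle is smooth. -/
theorem VectorSubbundle.contMDiffAt_starProjection (E : VectorSubbundle m p W r)
    (t : Fin p → localSections m p W U)
    (ht : ∀ x : U, LinearIndependent ℝ fun a => (t a).1 x) (x₀ : U)
    {w : U → EuclideanSpace ℝ (Fin p)}
    (hw : ContMDiffAt (𝓡 m) 𝓘(ℝ, EuclideanSpace ℝ (Fin p)) ∞ w x₀) :
    ContMDiffAt (𝓡 m) 𝓘(ℝ, EuclideanSpace ℝ (Fin p)) ∞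
      (fun x : U => (E.coordFiber t ht x).starProjection (w x)) x₀ := by
  classical
  obtain ⟨V, hV, s, hs⟩ := E.exists_frame x₀
  -- The frame of `E` lives over `V`, the frame `t` over `U`. Extension by zero to `M` allows the
  -- passage from `V` to `U`; only the germ at `x₀` matters.
  let s' : Fin r → ∀ x : M, W x := fun i x => if hx : x ∈ V then (s i).1 ⟨x, hx⟩ else 0
  have hs' : ∀ i (z : V), s' i z = (s i).1 z := fun i z => dif_pos z.2
  have hsm : ∀ i, ContMDiffAt (𝓡 m) 𝓘(ℝ, EuclideanSpace ℝ (Fin p)) ∞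
      (fun x : U => (trivializationAt (EuclideanSpace ℝ (Fin p)) W (x₀ : M)
        ⟨(x : M), s' i x⟩).2) x₀ := by
    intro i
    have h1 := (isSmoothSection_iff m p W V _).1 (s i).2 ⟨x₀, hV⟩
    simp only [← hs'] at h1
    have h2 := (contMDiffAt_subtype_iff (f := fun x : M =>
      (trivializationAt (EuclideanSpace ℝ (Fin p)) W (x₀ : M) ⟨x, s' i x⟩).2)).1 h1
    exact contMDiffAt_subtype_iff (f := fun x : M =>
      (trivializationAt (EuclideanSpace ℝ (Fin p)) W (x₀ : M) ⟨x, s' i x⟩).2).2 h2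
  have hVx : ∀ᶠ x : U in 𝓝 x₀, (x : M) ∈ V :=
    continuous_subtype_val.continuousAt.eventually (V.isOpen.mem_nhds hV)
  let σ : Fin r → U → EuclideanSpace ℝ (Fin p) := fun i x => (frameEquiv t ht x).symm (s' i x)
  have hσ : ∀ i, ContMDiffAt (𝓡 m) 𝓘(ℝ, EuclideanSpace ℝ (Fin p)) ∞ (σ i) x₀ :=
    fun i => contMDiffAt_frameEquiv_symm t ht x₀ (hsm i)
  have hli : ∀ᶠ x in 𝓝 x₀, LinearIndependent ℝ fun i => σ i x := by
    filter_upwards [hVx] with x hx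
    refine LinearIndependent.map' (v := fun i => s' i x) ?_ (frameEquiv t ht x).symm.toLinearMap
      (LinearEquiv.ker _)
    have := (hs ⟨x, hx⟩).1
    simpa only [← hs'] using this
  refine (contMDiffAt_starProjection_span hσ hli hw).congr_of_eventuallyEq ?_
  filter_upwards [hVx] with x hx
  have h1 : E.coordFiber t ht x = Submodule.span ℝ (range fun i => σ i x) := by
    have h2 := (hs ⟨x, hx⟩).2
    simp only [← hs'] at h2
    have h3 : (range fun i => σ i x) =
        (frameEquiv t ht x).symm.toLinearMap '' (range fun i => s' i x) :=
      range_comp (frameEquiv t ht x).symm (fun i => s' i x)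
    rw [h3, ← Submodule.map_span, h2]
    exact Submodule.comap_equiv_eq_map_symm _ _
  rw [h1]

/-- Over the domain of a bundle chart, the sections of a subbundle are complemented. -/
theorem VectorSubbundle.exists_projection (E : VectorSubbundle m p W r)
    (t : Fin p → localSections m p W U)
    (ht : ∀ x : U, LinearIndependent ℝ fun a => (t a).1 x) :
    ∃ P : localSections m p W U →ₗ[SmoothFun m U] localSections m p W U,
      (∀ S ∈ E.sections U, P S = 0) ∧ ∀ S, S - P S ∈ E.sections U := by
  -- The frame `t` transports the Euclidean inner product to the fibres over `U`. In coordinates, `q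
  -- S` is the component of `S` orthogonal to `E`, so the resulting `P` kills exactly the sections
  -- of `E`.
  let q : localSections m p W U → ∀ x : U, EuclideanSpace ℝ (Fin p) := fun S x =>
    (E.coordFiber t ht x)ᗮ.starProjection ((frameEquiv t ht x).symm (S.1 x))
  have hq : ∀ S, ContMDiff (𝓡 m) 𝓘(ℝ, EuclideanSpace ℝ (Fin p)) ∞ (q S) := by
    intro S x₀
    have h1 := contMDiffAt_frameEquiv_symm t ht x₀ ((isSmoothSection_iff m p W U _).1 S.2 x₀)
    refine (h1.sub (E.contMDiffAt_starProjection t ht x₀ h1)).congr_of_eventuallyEq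
      (Filter.Eventually.of_forall fun x => ?_)
    exact Submodule.starProjection_orthogonal_val _
  let f : localSections m p W U → Fin p → SmoothFun m U := fun S a =>
    ⟨fun x => q S x a, (EuclideanSpace.proj (𝕜 := ℝ) a).contDiff.contMDiff.comp (hq S)⟩
  have hval : ∀ S (x : U), (∑ a, f S a • t a).1 x = frameEquiv t ht x (q S x) := by
    intro S x
    rw [sum_smul_apply, frameEquiv_apply]
    rfl
  refine ⟨⟨⟨fun S => ∑ a, f S a • t a, fun S T => ?_⟩, fun g S => ?_⟩, fun S hS => ?_, fun S => ?_⟩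
  · refine Subtype.ext (funext fun x => ?_)
    change _ = (∑ a, f S a • t a).1 x + (∑ a, f T a • t a).1 x
    rw [hval, hval, hval, ← map_add]
    refine congrArg _ ?_
    change _ = Submodule.starProjection _ _ + Submodule.starProjection _ _
    rw [← map_add, ← map_add]
    rfl
  · refine Subtype.ext (funext fun x => ?_)
    change _ = g x • (∑ a, f S a • t a).1 x
    rw [hval, hval, ← map_smul]
    refine congrArg _ ?_
    change _ = g x • Submodule.starProjection _ _
    rw [← map_smul, ← map_smul]
    rfl
  · refine Subtype.ext (funext fun x => ?_)
    change (∑ a, f S a • t a).1 x = 0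
    rw [hval]
    have h1 : q S x = 0 := by
      refine Submodule.starProjection_orthogonal_apply_eq_zero ?_
      change frameEquiv t ht x _ ∈ E.fiber x
      rw [LinearEquiv.apply_symm_apply]
      exact hS x
    rw [h1, map_zero]
  · intro x
    change S.1 x - (∑ a, f S a • t a).1 x ∈ E.fiber x
    rw [hval]
    have h1 : (frameEquiv t ht x).symm (S.1 x) - q S x ∈ E.coordFiber t ht x := by
      change _ - Submodule.starProjection _ _ ∈ _
      rw [Submodule.starProjection_orthogonal_val, sub_sub_cancel]
      exact Submodule.starProjection_apply_mem _ _
    have h2 : frameEquiv t ht x ((frameEquiv t ht x).symm (S.1 x) - q S x) ∈ E.fiber x := h1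
    rwa [map_sub, LinearEquiv.apply_symm_apply] at h2

end Frame

end

/-! ### Local calculus of the pull-back Lie algebroid. -/

noncomputable section

section PullbackCalculus

variable {m n : ℕ} {M N : Type*}
  [TopologicalSpace M] [ChartedSpace (EuclideanSpace ℝ (Fin m)) M] [IsManifold (𝓡 m) ∞ M]
  [TopologicalSpace N] [ChartedSpace (EuclideanSpace ℝ (Fin n)) N] [IsManifold (𝓡 n) ∞ N]
  {p : ℕ} {F : N → Type*} [∀ y, AddCommGroup (F y)] [∀ y, Module ℝ (F y)]
  [∀ y, TopologicalSpace (F y)] [TopologicalSpace (TotalSpace (EuclideanSpace ℝ (Fin p)) F)]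
  [FiberBundle (EuclideanSpace ℝ (Fin p)) F] [VectorBundle ℝ (EuclideanSpace ℝ (Fin p)) F]
  [ContMDiffVectorBundle ∞ (EuclideanSpace ℝ (Fin p)) F (𝓡 n)]
  {h : M ≃ₘ⟮𝓡 m, 𝓡 n⟯ N} {η : N ≃ₘ⟮𝓡 n, 𝓡 m⟯ M} {U : Opens M}

/-- `localAnchor` differentiates the extension by zero; this replaces it by any function with the
same germ. -/
theorem extend_eventuallyEq {f : U → ℝ} {g : M → ℝ} {x : U} (hfg : ∀ᶠ z in 𝓝 x, f z = g z) :
    Function.extend Subtype.val f 0 =ᶠ[𝓝 (x : M)] g := by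
  rw [← U.isOpen.isOpenEmbedding_subtypeVal.map_nhds_eq x]
  exact hfg.mono fun z hz => (Subtype.val_injective.extend_apply f 0 z).trans hz

/-- A smooth function on an open subset is near each point the restriction of a smooth function. -/
theorem exists_eventually_eq [T2Space M] (f : SmoothFun m U) (x : U) :
    ∃ g : C^∞⟮𝓡 m, M; 𝓘(ℝ, ℝ), ℝ⟯, ∀ᶠ z in 𝓝 x, f z = g z := by
  obtain ⟨g, hg⟩ := exists_smooth_germ f x
  refine ⟨g, ?_⟩
  filter_upwards [continuous_subtype_val.continuousAt.eventually hg] with z hz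
  rwa [Subtype.val_injective.extend_apply] at hz

/-- The transport to `N` of a smooth function on `M`. -/
def pushFun (h : M ≃ₘ⟮𝓡 m, 𝓡 n⟯ N) (g : C^∞⟮𝓡 m, M; 𝓘(ℝ, ℝ), ℝ⟯) :
    C^∞⟮𝓡 n, N; 𝓘(ℝ, ℝ), ℝ⟯ :=
  ⟨fun y => g (h.symm y), g.contMDiff.comp h.symm.contMDiff⟩

theorem pushFun_apply (g : C^∞⟮𝓡 m, M; 𝓘(ℝ, ℝ), ℝ⟯) (x : M) : pushFun h g (h x) = g x :=
  congrArg g (h.symm_apply_apply x)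

theorem Induces.add {u v : GlobalSection (n := n) p F} {S T : localSections m p (h *ᵖ F) U} {x : U}
    (hu : Induces u S x) (hv : Induces v T x) : Induces (u + v) (S + T) x := by
  filter_upwards [hu, hv] with z hz hz'
  exact congrArg₂ (fun a b : F (h z) => a + b) hz hz'

theorem Induces.mulSection {u : GlobalSection (n := n) p F} {S : localSections m p (h *ᵖ F) U}
    {x : U} (hu : Induces u S x) {f : SmoothFun m U} {g : C^∞⟮𝓡 m, M; 𝓘(ℝ, ℝ), ℝ⟯}
    (hf : ∀ᶠ z in 𝓝 x, f z = g z) : Induces (mulSection (pushFun h g) u) (f • S) x := by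
  filter_upwards [hu, hf] with z hz hz'
  change f z • S.1 z = (show F (h z) from pushFun h g (h z) • u (h z))
  rw [pushFun_apply, hz', hz]
  rfl

namespace GeneralizedLieAlgebroid

variable (A : GeneralizedLieAlgebroid p F h η)

theorem localAnchor_apply' [T2Space M] {u : GlobalSection (n := n) p F}
    {S : localSections m p (h *ᵖ F) U} {f : SmoothFun m U} {g : C^∞⟮𝓡 m, M; 𝓘(ℝ, ℝ), ℝ⟯} {x : U}
    (hu : Induces u S x) (hf : ∀ᶠ z in 𝓝 x, f z = g z) :
    A.localAnchor U S f x = A.pullbackAnchorDeriv u g x :=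
  A.localAnchor_apply hu g.contMDiff (extend_eventuallyEq hf)

theorem pullbackAnchorDeriv_add_fun (u : GlobalSection (n := n) p F)
    (f g : C^∞⟮𝓡 m, M; 𝓘(ℝ, ℝ), ℝ⟯) (x : M) :
    A.pullbackAnchorDeriv u (f + g) x =
      A.pullbackAnchorDeriv u f x + A.pullbackAnchorDeriv u g x := by
  have h1 := mfderiv_add (f.contMDiff.mdifferentiable (by simp) (η (η.symm x)))
    (g.contMDiff.mdifferentiable (by simp) (η (η.symm x)))
  exact congrArg (fun L : EuclideanSpace ℝ (Fin m) →L[ℝ] ℝ => L (A.ρ (η.symm x) (u (η.symm x)))) h1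

theorem pullbackAnchorDeriv_mul_fun (u : GlobalSection (n := n) p F)
    (f g : C^∞⟮𝓡 m, M; 𝓘(ℝ, ℝ), ℝ⟯) (x : M) :
    A.pullbackAnchorDeriv u (f * g) x =
      f x * A.pullbackAnchorDeriv u g x + A.pullbackAnchorDeriv u f x * g x := by
  have h1 := ((f.contMDiff.mdifferentiable (by simp) (η (η.symm x))).hasMFDerivAt.mul
    (g.contMDiff.mdifferentiable (by simp) (η (η.symm x))).hasMFDerivAt).mfderiv
  have h2 := congrArg
    (fun L : EuclideanSpace ℝ (Fin m) →L[ℝ] ℝ => L (A.ρ (η.symm x) (u (η.symm x)))) h1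
  refine h2.trans ?_
  change f (η (η.symm x)) * A.pullbackAnchorDeriv u g x +
    g (η (η.symm x)) * A.pullbackAnchorDeriv u f x = _
  have hf : f (η (η.symm x)) = f x := congrArg f (η.apply_symm_apply x)
  have hg : g (η (η.symm x)) = g x := congrArg g (η.apply_symm_apply x)
  rw [hf, hg, mul_comm (g x)]

theorem pullbackAnchorDeriv_add (u v : GlobalSection (n := n) p F) (f : M → ℝ) (x : M) :
    A.pullbackAnchorDeriv (u + v) f x =
      A.pullbackAnchorDeriv u f x + A.pullbackAnchorDeriv v f x := by
  have h1 : A.ρ (η.symm x) ((u + v) (η.symm x)) =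
      A.ρ (η.symm x) (u (η.symm x)) + A.ρ (η.symm x) (v (η.symm x)) := map_add _ _ _
  exact (congrArg (mfderiv (𝓡 m) 𝓘(ℝ, ℝ) f (η (η.symm x))) h1).trans (map_add _ _ _)

theorem pullbackAnchorDeriv_smul_apply (u : GlobalSection (n := n) p F)
    (g : C^∞⟮𝓡 n, N; 𝓘(ℝ, ℝ), ℝ⟯) (f : M → ℝ) (x : M) :
    A.pullbackAnchorDeriv (mulSection g u) f x =
      g (η.symm x) * A.pullbackAnchorDeriv u f x := by
  have h1 : A.ρ (η.symm x) (mulSection g u (η.symm x)) =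
      g (η.symm x) • A.ρ (η.symm x) (u (η.symm x)) := map_smul _ _ _
  exact (congrArg (mfderiv (𝓡 m) 𝓘(ℝ, ℝ) f (η (η.symm x))) h1).trans (map_smul _ _ _)

/-- The anchor of the pull-back algebroid vanishes at the points where `η⁻¹` and `h` differ, since
it is local and depends on the values of the sections at `η⁻¹` only. -/
theorem pullbackAnchorDeriv_eq_zero_of_ne [T2Space M] (u : GlobalSection (n := n) p F)
    (f : C^∞⟮𝓡 m, M; 𝓘(ℝ, ℝ), ℝ⟯) {x : M} (hx : η.symm x ≠ h x) :
    A.pullbackAnchorDeriv u f x = 0 := by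
  have : T2Space N := t2Space h
  obtain ⟨φ, hφ1, hφ2⟩ := exists_bump (n := n) (h x) {η.symm x}ᶜ
    (isOpen_compl_singleton.mem_nhds (by simpa using hx.symm))
  have h1 : φ (η.symm x) = 0 :=
    image_eq_zero_of_notMem_tsupport fun h0 => hφ2 h0 rfl
  have h2 : ∀ᶠ y in 𝓝 (h x), u y = mulSection φ u y := by
    filter_upwards [hφ1] with y hy
    change u y = φ y • u y
    rw [hy]
    exact (one_smul ℝ _).symm
  rw [A.pullbackAnchorDeriv_congr h2 (Filter.EventuallyEq.refl _ _) f.contMDiff,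
    pullbackAnchorDeriv_smul_apply, h1, zero_mul]

/-- The anchor sees the factor at η⁻¹(x), whereas multiplying sections of h*F by functions evaluates
it at h(x). Where the two points differ both sides vanish, and this makes the anchor linear over the
smooth functions. -/
theorem pullbackAnchorDeriv_mulSection [T2Space M] (u : GlobalSection (n := n) p F)
    (g : C^∞⟮𝓡 n, N; 𝓘(ℝ, ℝ), ℝ⟯) (f : C^∞⟮𝓡 m, M; 𝓘(ℝ, ℝ), ℝ⟯) (x : M) :
    A.pullbackAnchorDeriv (mulSection g u) f x = g (h x) * A.pullbackAnchorDeriv u f x := by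
  by_cases hx : η.symm x = h x
  · rw [pullbackAnchorDeriv_smul_apply, hx]
  · rw [A.pullbackAnchorDeriv_eq_zero_of_ne _ f hx, A.pullbackAnchorDeriv_eq_zero_of_ne u f hx,
      mul_zero]

variable [T2Space M]

theorem localAnchor_add_fun (S : localSections m p (h *ᵖ F) U) (f g : SmoothFun m U) :
    A.localAnchor U S (f + g) = A.localAnchor U S f + A.localAnchor U S g := by
  ext x
  obtain ⟨u, hu⟩ := exists_induces S x
  obtain ⟨f', hf⟩ := exists_eventually_eq f x
  obtain ⟨g', hg⟩ := exists_eventually_eq g x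
  change _ = A.localAnchor U S f x + A.localAnchor U S g x
  rw [A.localAnchor_apply' hu hf, A.localAnchor_apply' hu hg, A.localAnchor_apply' hu
    (g := f' + g') (by filter_upwards [hf, hg] with z hz hz' using congrArg₂ (· + ·) hz hz')]
  exact A.pullbackAnchorDeriv_add_fun u f' g' x

theorem localAnchor_mul_fun (S : localSections m p (h *ᵖ F) U) (f g : SmoothFun m U) :
    A.localAnchor U S (f * g) = f * A.localAnchor U S g + A.localAnchor U S f * g := by
  ext x
  obtain ⟨u, hu⟩ := exists_induces S x
  obtain ⟨f', hf⟩ := exists_eventually_eq f x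
  obtain ⟨g', hg⟩ := exists_eventually_eq g x
  change _ = f x * A.localAnchor U S g x + A.localAnchor U S f x * g x
  rw [A.localAnchor_apply' hu hf, A.localAnchor_apply' hu hg, hf.self_of_nhds, hg.self_of_nhds,
    A.localAnchor_apply' hu
    (g := f' * g') (by filter_upwards [hf, hg] with z hz hz' using congrArg₂ (· * ·) hz hz')]
  exact A.pullbackAnchorDeriv_mul_fun u f' g' x

theorem localAnchor_add (S T : localSections m p (h *ᵖ F) U) (f : SmoothFun m U) :
    A.localAnchor U (S + T) f = A.localAnchor U S f + A.localAnchor U T f := by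
  ext x
  obtain ⟨u, hu⟩ := exists_induces S x
  obtain ⟨v, hv⟩ := exists_induces T x
  obtain ⟨f', hf⟩ := exists_eventually_eq f x
  change _ = A.localAnchor U S f x + A.localAnchor U T f x
  rw [A.localAnchor_apply' hu hf, A.localAnchor_apply' hv hf, A.localAnchor_apply' (hu.add hv) hf]
  exact A.pullbackAnchorDeriv_add u v f' x

theorem localAnchor_smul (a : SmoothFun m U) (S : localSections m p (h *ᵖ F) U)
    (f : SmoothFun m U) : A.localAnchor U (a • S) f = a * A.localAnchor U S f := by
  ext x
  obtain ⟨u, hu⟩ := exists_induces S x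
  obtain ⟨a', ha⟩ := exists_eventually_eq a x
  obtain ⟨f', hf⟩ := exists_eventually_eq f x
  change _ = a x * A.localAnchor U S f x
  rw [A.localAnchor_apply' hu hf, A.localAnchor_apply' (hu.mulSection ha) hf,
    pullbackAnchorDeriv_mulSection, pushFun_apply, ha.self_of_nhds]

theorem localBracket_skew (S T : localSections m p (h *ᵖ F) U) :
    A.localBracket U S T = -A.localBracket U T S := by
  refine Subtype.ext (funext fun x => ?_)
  obtain ⟨u, hu⟩ := exists_induces S x
  obtain ⟨v, hv⟩ := exists_induces T x
  change _ = -(A.localBracket U T S).1 x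
  rw [A.localBracket_apply hu hv, A.localBracket_apply hv hu, A.bracket_skew]
  rfl

theorem localBracket_add (S T T' : localSections m p (h *ᵖ F) U) :
    A.localBracket U S (T + T') = A.localBracket U S T + A.localBracket U S T' := by
  refine Subtype.ext (funext fun x => ?_)
  obtain ⟨u, hu⟩ := exists_induces S x
  obtain ⟨v, hv⟩ := exists_induces T x
  obtain ⟨v', hv'⟩ := exists_induces T' x
  change _ = (A.localBracket U S T).1 x + (A.localBracket U S T').1 x
  rw [A.localBracket_apply hu hv, A.localBracket_apply hu hv',
    A.localBracket_apply hu (hv.add hv'), A.bracket_add]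
  rfl

/-- Every term depends only on germs at the point, so the Leibniz rule on `N` applies to global
representatives; the chain rule in `anchorDeriv_eq` turns its derivative term into the anchor of
h*F. -/
theorem localBracket_smul (S : localSections m p (h *ᵖ F) U) (a : SmoothFun m U)
    (T : localSections m p (h *ᵖ F) U) :
    A.localBracket U S (a • T) = a • A.localBracket U S T + A.localAnchor U S a • T := by
  refine Subtype.ext (funext fun x => ?_)
  obtain ⟨u, hu⟩ := exists_induces S x
  obtain ⟨v, hv⟩ := exists_induces T x
  obtain ⟨a', ha⟩ := exists_eventually_eq a x
  change _ = a x • (A.localBracket U S T).1 x + A.localAnchor U S a x • T.1 x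
  rw [A.localBracket_apply hu hv, A.localBracket_apply hu (hv.mulSection ha),
    A.localAnchor_apply' hu ha, hv.self_of_nhds, ha.self_of_nhds]
  refine (A.leibniz u v (pushFun h a') (h x)).trans ?_
  rw [A.anchorDeriv_eq]
  simp only [pushFun_apply]
  rfl

theorem extDeriv_skew (θ : OneForm m p (h *ᵖ F) U) (S T : localSections m p (h *ᵖ F) U) :
    A.extDeriv U θ S T = -A.extDeriv U θ T S := by
  unfold extDeriv
  rw [A.localBracket_skew S T, map_neg]
  ring

theorem extDeriv_add (θ : OneForm m p (h *ᵖ F) U) (S T T' : localSections m p (h *ᵖ F) U) :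
    A.extDeriv U θ S (T + T') = A.extDeriv U θ S T + A.extDeriv U θ S T' := by
  unfold extDeriv
  rw [map_add, A.localBracket_add, map_add, A.localAnchor_add_fun, A.localAnchor_add]
  ring

/-- The term ρ(S)(a) θ(T) arises twice, from differentiating a θ(T) and from the bracket [S, aT],
with opposite signs. -/
theorem extDeriv_smul (θ : OneForm m p (h *ᵖ F) U) (S : localSections m p (h *ᵖ F) U)
    (a : SmoothFun m U) (T : localSections m p (h *ᵖ F) U) :
    A.extDeriv U θ S (a • T) = a • A.extDeriv U θ S T := by
  unfold extDeriv
  rw [map_smul, A.localBracket_smul, map_add, map_smul, map_smul, A.localAnchor_smul]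
  simp only [smul_eq_mul]
  rw [A.localAnchor_mul_fun]
  ring

/-- The differential of a `1`-form, as a bilinear form. -/
def extDerivBilin (θ : OneForm m p (h *ᵖ F) U) :
    localSections m p (h *ᵖ F) U →ₗ[SmoothFun m U] Module.Dual (SmoothFun m U)
      (localSections m p (h *ᵖ F) U) :=
  LinearMap.mk₂ _ (A.extDeriv U θ)
    (fun S S' T => by
      rw [A.extDeriv_skew, A.extDeriv_add, neg_add, ← A.extDeriv_skew, ← A.extDeriv_skew])
    (fun a S T => by rw [A.extDeriv_skew, A.extDeriv_smul, ← smul_neg, ← A.extDeriv_skew])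
    (A.extDeriv_add θ) (fun a S T => A.extDeriv_smul θ S a T)

/-- A section over `U` with values in a subbundle coincides near each point with a global section
with values in the subbundle. -/
theorem exists_global_section {r : ℕ} {E : VectorSubbundle m p (h *ᵖ F) r}
    {S : localSections m p (h *ᵖ F) U} (hS : S ∈ E.sections U) (x : U) :
    ∃ u : GlobalSection (n := n) p F, Induces u S x ∧ pullbackSection h ⊤ u ∈ E.sections ⊤ := by
  obtain ⟨u, hu⟩ := exists_induces S x
  have h1 : ∀ᶠ z : M in 𝓝 (x : M), u (h z) ∈ E.fiber z := by
    rw [← U.isOpen.isOpenEmbedding_subtypeVal.map_nhds_eq x, Filter.eventually_map]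
    filter_upwards [hu] with z hz
    have := hS z
    rwa [hz] at this
  -- The support of the cut-off lies where u ∘ h takes values in `E`, so the product has values in
  -- `E` everywhere. Near `x` the factor is 1, whence `S` is treated as `1 • S`.
  obtain ⟨φ, hφ1, hφ2⟩ := exists_bump (n := m) (x : M) _ h1
  have h2 : Induces (mulSection (pushFun h φ) u) ((1 : SmoothFun m U) • S) x :=
    hu.mulSection (continuous_subtype_val.continuousAt.eventually
      (hφ1.mono fun z hz => Eq.symm hz))
  rw [one_smul] at h2
  refine ⟨_, h2, fun z => ?_⟩
  change (pushFun h φ (h z) • u (h z) : F (h z)) ∈ E.fiber z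
  rw [pushFun_apply]
  by_cases hz : (z : M) ∈ tsupport φ
  · exact (E.fiber z).smul_mem _ (hφ2 hz)
  · rw [image_eq_zero_of_notMem_tsupport hz]
    have h3 : (0 : ℝ) • u (h z) = 0 := zero_smul _ _
    rw [h3]
    exact (E.fiber z).zero_mem

end GeneralizedLieAlgebroid

end PullbackCalculus

end

/-! ### Localisation of involutivity and the Frobenius criterion. -/

noncomputable section

section Frobenius

variable {m n : ℕ} {M N : Type*}
  [TopologicalSpace M] [ChartedSpace (EuclideanSpace ℝ (Fin m)) M] [IsManifold (𝓡 m) ∞ M]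
  [TopologicalSpace N] [ChartedSpace (EuclideanSpace ℝ (Fin n)) N] [IsManifold (𝓡 n) ∞ N]
  {p : ℕ} {F : N → Type*} [∀ y, AddCommGroup (F y)] [∀ y, Module ℝ (F y)]
  [∀ y, TopologicalSpace (F y)] [TopologicalSpace (TotalSpace (EuclideanSpace ℝ (Fin p)) F)]
  [FiberBundle (EuclideanSpace ℝ (Fin p)) F] [VectorBundle ℝ (EuclideanSpace ℝ (Fin p)) F]
  [ContMDiffVectorBundle ∞ (EuclideanSpace ℝ (Fin p)) F (𝓡 n)]
  {h : M ≃ₘ⟮𝓡 m, 𝓡 n⟯ N} {η : N ≃ₘ⟮𝓡 n, 𝓡 m⟯ M} {U : Opens M}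
  [T2Space M] (A : GeneralizedLieAlgebroid p F h η) {r : ℕ}
  (E : VectorSubbundle m p (h *ᵖ F) r)

/-- Supplies the scalar one half required by `exists_eq_sum_wedge`. -/
theorem exists_smoothFun_half (U : Opens M) : ∃ c : SmoothFun m U, c + c = 1 :=
  ⟨⟨fun _ => 1 / 2, contMDiff_const⟩, by
    ext x
    exact add_halves (1 : ℝ)⟩

theorem sum_wedge_apply {ι : Type*} [Fintype ι] (ψ θ : ι → OneForm m p (h *ᵖ F) U)
    (S T : localSections m p (h *ᵖ F) U) :
    (∑ i, wedge (ψ i) (θ i)) S T = ∑ i, (ψ i S * θ i T - ψ i T * θ i S) := by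
  simp only [Finset.sum_apply]
  rfl

namespace GeneralizedLieAlgebroid

theorem induces_pullbackSection (u : GlobalSection (n := n) p F) (x : U) :
    Induces u (pullbackSection h U u) x :=
  Filter.Eventually.of_forall fun _ => rfl

variable {A E} in
/-- The sections over `U` of an involutive subbundle are closed under the bracket. -/
theorem Involutive.localBracket_mem (hE : A.Involutive E) {S T : localSections m p (h *ᵖ F) U}
    (hS : S ∈ E.sections U) (hT : T ∈ E.sections U) : A.localBracket U S T ∈ E.sections U := by
  intro x
  obtain ⟨u, hu, hu'⟩ := exists_global_section (n := n) hS x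
  obtain ⟨v, hv, hv'⟩ := exists_global_section (n := n) hT x
  have h1 := hE _ hu' _ hv' ⟨x, trivial⟩
  rw [A.localBracket_apply (induces_pullbackSection u _) (induces_pullbackSection v _)] at h1
  rw [A.localBracket_apply hu hv]
  exact h1

/-- Involutivity can be checked on the members of an open cover. -/
theorem involutive_of_cover {𝒰 : Set (Opens M)} (hcover : ∀ x, ∃ U ∈ 𝒰, x ∈ U)
    (hU : ∀ U ∈ 𝒰, ∀ S ∈ E.sections U, ∀ T ∈ E.sections U, A.localBracket U S T ∈ E.sections U) :
    A.Involutive E := by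
  intro S hS T hT x
  obtain ⟨U, hU𝒰, hx⟩ := hcover x
  -- With `u` and `v` representing the sections near `x`, the brackets over `U` and over all of `M`
  -- have the same value at `x`, namely that of `A.bracket u v` at h(x).
  obtain ⟨u, hu, hu'⟩ := exists_global_section (n := n) hS x
  obtain ⟨v, hv, hv'⟩ := exists_global_section (n := n) hT x
  have h1 := hU U hU𝒰 (pullbackSection h U u) (fun z => hu' ⟨z, trivial⟩)
    (pullbackSection h U v) (fun z => hv' ⟨z, trivial⟩) ⟨x, hx⟩
  rw [A.localBracket_apply (induces_pullbackSection u _) (induces_pullbackSection v _)] at h1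
  rw [A.localBracket_apply hu hv]
  exact h1

theorem localAnchor_zero (S : localSections m p (h *ᵖ F) U) : A.localAnchor U S 0 = 0 := by
  have h1 := A.localAnchor_add_fun S 0 0
  rwa [add_zero, left_eq_add] at h1

/-- The link between the two sides of the criterion: on the kernel of θ only the bracket term of the
differential survives. -/
theorem extDeriv_of_apply_eq_zero {θ : OneForm m p (h *ᵖ F) U}
    {S T : localSections m p (h *ᵖ F) U} (hS : θ S = 0) (hT : θ T = 0) :
    A.extDeriv U θ S T = -θ (A.localBracket U S T) := by
  unfold extDeriv
  rw [hS, hT, localAnchor_zero, localAnchor_zero, sub_zero, zero_sub]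

/-- If the common kernel of `1`-forms with a dual family is closed under the bracket, then the
differential of each of them belongs to the ideal generated by them. -/
theorem exists_extDeriv_eq_sum_wedge {ι : Type*} [Fintype ι] [DecidableEq ι]
    (θ : ι → OneForm m p (h *ᵖ F) U) (e : ι → localSections m p (h *ᵖ F) U)
    (he : ∀ α β, θ α (e β) = if α = β then 1 else 0)
    (hθ : ∀ S T, (∀ α, θ α S = 0) → (∀ α, θ α T = 0) → ∀ α, θ α (A.localBracket U S T) = 0)
    (α : ι) :
    ∃ Ω : ι → OneForm m p (h *ᵖ F) U, A.extDeriv U (θ α) = ∑ β, wedge (Ω β) (θ β) := by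
  obtain ⟨c, hc⟩ := exists_smoothFun_half (m := m) U
  have hzero : ∀ S T, (∀ β, θ β S = 0) → (∀ β, θ β T = 0) → A.extDerivBilin (θ α) S T = 0 := by
    intro S T hS hT
    have h2 := A.extDeriv_of_apply_eq_zero (hS α) (hT α)
    rw [hθ S T hS hT α, neg_zero] at h2
    exact h2
  obtain ⟨Ω, hΩ⟩ := exists_eq_sum_wedge (A.extDerivBilin (θ α)) (A.extDeriv_skew _) θ e he hzero
    c hc
  refine ⟨Ω, funext fun S => funext fun T => ?_⟩
  rw [sum_wedge_apply]
  exact hΩ S T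

/-- If the differentials of `1`-forms belong to the ideal generated by them, then their common
kernel is closed under the bracket. -/
theorem apply_localBracket_eq_zero {ι : Type*} [Fintype ι] {θ : ι → OneForm m p (h *ᵖ F) U} {α : ι}
    {Ω : ι → OneForm m p (h *ᵖ F) U} (hΩ : A.extDeriv U (θ α) = ∑ β, wedge (Ω β) (θ β))
    {S T : localSections m p (h *ᵖ F) U} (hS : ∀ β, θ β S = 0) (hT : ∀ β, θ β T = 0) :
    θ α (A.localBracket U S T) = 0 := by
  have h1 := A.extDeriv_of_apply_eq_zero (hS α) (hT α)
  rw [hΩ, sum_wedge_apply] at h1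
  rw [← neg_eq_zero, ← h1]
  refine Finset.sum_eq_zero fun β _ => ?_
  rw [hS β, hT β, mul_zero, mul_zero, sub_zero]

/-- Over the domain of a bundle chart, the sections of `E` are closed under the bracket if and
only if the differentials of a basis of the annihilator belong to the ideal generated by it. -/
theorem forall_localBracket_mem_iff {ι : Type*} [Fintype ι]
    (hU : IsBundleChartDomain m p (h *ᵖ F) U)
    (Θ : Module.Basis ι (SmoothFun m U) (E.annihilator U)) :
    (∀ S ∈ E.sections U, ∀ T ∈ E.sections U, A.localBracket U S T ∈ E.sections U) ↔
      ∃ Ω : ι → ι → OneForm m p (h *ᵖ F) U,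
        ∀ α, A.extDeriv U (Θ α).1 = ∑ β, wedge (Ω α β) (Θ β).1 := by
  classical
  obtain ⟨t, ht⟩ := hU
  obtain ⟨P, hP, hP'⟩ := E.exists_projection t ht
  -- Membership in Γ(E|U) becomes the vanishing of finitely many forms, so closure under the bracket
  -- becomes a statement about the `Θ α` alone.
  have hmem : ∀ S, S ∈ E.sections U ↔ ∀ α, (Θ α).1 S = 0 := fun S =>
    ⟨fun hS α => (Submodule.mem_dualAnnihilator _).1 (Θ α).2 S hS,
      mem_of_forall_basis_eq_zero (frameBasis t ht) P hP hP' Θ S⟩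
  obtain ⟨e, he⟩ := exists_dual_family (frameBasis t ht) P hP hP' Θ
  simp only [hmem]
  constructor
  · intro hE
    choose Ω hΩ using A.exists_extDeriv_eq_sum_wedge (fun β => (Θ β).1) e he
      (fun S T hS hT => hE S hS T hT)
    exact ⟨Ω, hΩ⟩
  · rintro ⟨Ω, hΩ⟩ S hS T hT α
    exact A.apply_localBracket_eq_zero (θ := fun β => (Θ β).1) (hΩ α) hS hT

end GeneralizedLieAlgebroid

end Frobenius

end

end GenLie

theorem mainTheorem9 {m n p r : ℕ} {M N : Type*}
    [TopologicalSpace M] [ChartedSpace (EuclideanSpace ℝ (Fin m)) M] [IsManifold (𝓡 m) ∞ M]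
    [T2Space M]
    [TopologicalSpace N] [ChartedSpace (EuclideanSpace ℝ (Fin n)) N] [IsManifold (𝓡 n) ∞ N]
    (F : N → Type*) [∀ y, AddCommGroup (F y)] [∀ y, Module ℝ (F y)]
    [∀ y, TopologicalSpace (F y)] [TopologicalSpace (TotalSpace (EuclideanSpace ℝ (Fin p)) F)]
    [FiberBundle (EuclideanSpace ℝ (Fin p)) F] [VectorBundle ℝ (EuclideanSpace ℝ (Fin p)) F]
    [ContMDiffVectorBundle ∞ (EuclideanSpace ℝ (Fin p)) F (𝓡 n)]
    (h : M ≃ₘ⟮𝓡 m, 𝓡 n⟯ N) (η : N ≃ₘ⟮𝓡 n, 𝓡 m⟯ M)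
    (A : GenLie.GeneralizedLieAlgebroid p F h η)
    (E : GenLie.VectorSubbundle m p (h *ᵖ F) r)
    (𝒜 : Set (OpenPartialHomeomorph M (EuclideanSpace ℝ (Fin m))))
    (h𝒜 : ∀ c ∈ 𝒜, c ∈ IsManifold.maximalAtlas (𝓡 m) ∞ M)
    (h𝒜_bundle : ∀ c ∈ 𝒜, GenLie.IsBundleChartDomain m p (h *ᵖ F) ⟨c.source, c.open_source⟩)
    (h𝒜_cover : ∀ x : M, ∃ c ∈ 𝒜, x ∈ c.source)
    (Θ : ∀ c : 𝒜, Module.Basis (Fin (p - r)) (GenLie.SmoothFun m ⟨c.1.source, c.1.open_source⟩)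
      (E.annihilator ⟨c.1.source, c.1.open_source⟩)) :
    A.Involutive E ↔
      ∀ c : 𝒜, ∃ Ω : Fin (p - r) → Fin (p - r) →
          GenLie.OneForm m p (h *ᵖ F) ⟨c.1.source, c.1.open_source⟩,
        ∀ α, A.extDeriv ⟨c.1.source, c.1.open_source⟩ (Θ c α).1 =
          ∑ β, GenLie.wedge (Ω α β) (Θ c β).1 := by
  constructor
  · intro hE c
    exact (A.forall_localBracket_mem_iff E (h𝒜_bundle c.1 c.2) (Θ c)).1
      fun S hS T hT => hE.localBracket_mem hS hT
  · intro hΩ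
    refine A.involutive_of_cover E
      (𝒰 := {U | ∃ c : 𝒜, U = ⟨c.1.source, c.1.open_source⟩}) (fun x => ?_) ?_
    · obtain ⟨c, hc, hx⟩ := h𝒜_cover x
      exact ⟨_, ⟨⟨c, hc⟩, rfl⟩, hx⟩
    · rintro _ ⟨c, rfl⟩
      exact (A.forall_localBracket_mem_iff E (h𝒜_bundle c.1 c.2) (Θ c)).2 (hΩ c)
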